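/- Let $k$ be a number of copies, let $Q$ be a smooth finite-dimensional manifold and let $G$ be a Lie group with Lie algebra $\mathfrak g$ acting smoothly, freely and properly on $Q$ (on the left), with $\pi\colon Q\to Q/G$ the projection and $\xi_Q$ the infinitesimal generator of $\xi\in\mathfrak g$. Let $T^1_kQ=TQ\oplus\cdots\oplus TQ$ ($k$ copies), on which $G$ acts by $g\cdot(v_{1q},\dots,v_{kq})=(T_q\Phi_g(v_{1q}),\dots,T_q\Phi_g(v_{kq}))$, $\Phi_g(q)=g\cdot q$. Let $L\colon T^1_kQ\to\mathbb R$ be smooth and $G$-invariant, with momentum map $J_L\colon T^1_kQ\to(\mathfrak g^*)^k$ given by $$\langle J_L^a(\pmb v_q),\xi\rangle=\frac{d}{ds}\Big|_{s=0}L(v_{1q},\dots,v_{aq}+s\,\xi_Q(q),\dots,v_{kq}),\qquad a=1,\dots,k.$$ Assume that $L$ is $G$-regular: for each $\pmb v_q=(v_{1q},\dots,v_{kq})\in T^1_kQ$ the map $$\mathfrak g^k\to(\mathfrak g^*)^k,\qquad(\xi_1,\dots,\xi_k)\mapsto J_L\big(v_{1q}+(\xi_1)_Q(q),\dots,v_{kq}+(\xi_k)_Q(q)\big)$$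 is a diffeomorphism. Let $\mu=(\mu_1,\dots,\mu_k)\in(\mathfrak g^*)^k$ and let $G_\mu=\{g\in G:\mathrm{Ad}_{g^{-1}}^*\mu_a=\mu_a,\ a=1,\dots,k\}$ be its isotropy group under the $k$-coadjoint action. Let $Q/G$ and $Q/G_\mu$ carry their quotient manifold structures (the smooth structures on the orbit spaces for which the projections from $Q$ are submersions), and let $p_\mu\colon Q/G_\mu\to Q/G$, $[q]_\mu\mapsto[q]$. Then $p_\mu$ is smooth, $J_L^{-1}(\mu)$ is an embedded submanifold of $T^1_kQ$, the quotient $J_L^{-1}(\mu)/G_\mu$ is a smooth manifold for which the projection $J_L^{-1}(\mu)\to J_L^{-1}(\mu)/G_\mu$ is a submersion, and there is a diffeomorphism $$J_L^{-1}(\mu)/G_\mu\;\simeq\;Q/G_\mu\times_{Q/G}\big(T(Q/G)\oplus\cdots\oplus T(Q/G)\big)\qquad(k\text{ copies}),$$ where the right-hand side is the pullback bundle $p_\mu^*\big(T^1_k(Q/G)\big)$. It covers the identity of $Q/G_\mu$ and is induced by $\pmb v_q\mapsto(q,T\pi(v_{1q}),\dots,T\pi(v_{kq}))$, i.e. it sends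 the class of $\pmb v_q\in J_L^{-1}(\mu)$ to $([q]_\mu,T\pi(v_{1q}),\dots,T\pi(v_{kq}))$. -/

import Mathlib

open scoped Manifold ContDiff Bundle

noncomputable section

namespace PolyRouth

section VelocityBundle

variable (E : Type*) [NormedAddCommGroup E] [NormedSpace ℝ E] (k : ℕ)

/-- The continuous linear map sending an endomorphism `A` of `E` to `A × ⋯ × A` on `E^k`. -/
def diag : (E →L[ℝ] E) →L[ℝ] ((Fin k → E) →L[ℝ] (Fin k → E)) :=
  ∑ a : Fin k,
    (ContinuousLinearMap.compL ℝ (Fin k → E) E (Fin k → E)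
        (ContinuousLinearMap.single ℝ (fun _ : Fin k => E) a)).comp
      ((ContinuousLinearMap.compL ℝ (Fin k → E) E E).flip
        (ContinuousLinearMap.proj (R := ℝ) (φ := fun _ : Fin k => E) a))

variable {E k} in
@[simp] theorem diag_apply (A : E →L[ℝ] E) (v : Fin k → E) (a : Fin k) :
    diag E k A v a = A (v a) := by
  classical
  simp [diag, Finset.sum_apply, Pi.single_apply]

variable (M : Type*) [TopologicalSpace M] [ChartedSpace E M]

/-- The vector bundle core of `TM ⊕ ⋯ ⊕ TM` (`k` copies): over each chart domain the fibre is
`E^k`, and the derivatives of the coordinate changes of `M` act on each of the `k` components. -/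
def velocityCore [IsManifold 𝓘(ℝ, E) 1 M] :
    VectorBundleCore ℝ M (Fin k → E) (atlas E M) where
  baseSet := (tangentBundleCore 𝓘(ℝ, E) M).baseSet
  isOpen_baseSet := (tangentBundleCore 𝓘(ℝ, E) M).isOpen_baseSet
  indexAt := (tangentBundleCore 𝓘(ℝ, E) M).indexAt
  mem_baseSet_at := (tangentBundleCore 𝓘(ℝ, E) M).mem_baseSet_at
  coordChange i j x := diag E k ((tangentBundleCore 𝓘(ℝ, E) M).coordChange i j x)
  coordChange_self i x hx v := by
    funext a
    simpa using (tangentBundleCore 𝓘(ℝ, E) M).coordChange_self i x hx (v a)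
  continuousOn_coordChange i j :=
    (diag E k).continuous.comp_continuousOn
      ((tangentBundleCore 𝓘(ℝ, E) M).continuousOn_coordChange i j)
  coordChange_comp i j l x hx v := by
    funext a
    simpa using (tangentBundleCore 𝓘(ℝ, E) M).coordChange_comp i j l x hx (v a)

instance velocityCore_isContMDiff [IsManifold 𝓘(ℝ, E) ∞ M] :
    (velocityCore E k M).IsContMDiff 𝓘(ℝ, E) ∞ := by
  have : IsManifold 𝓘(ℝ, E) (∞ + 1) M := ‹IsManifold 𝓘(ℝ, E) ∞ M›
  have : (tangentBundleCore 𝓘(ℝ, E) M).IsContMDiff 𝓘(ℝ, E) ∞ := tangentBundleCore.isContMDiff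
  exact ⟨fun i j => (diag E k).contMDiff.comp_contMDiffOn
    ((tangentBundleCore 𝓘(ℝ, E) M).contMDiffOn_coordChange 𝓘(ℝ, E) i j)⟩

variable {M}

/-- The fibre `T_xM ⊕ ⋯ ⊕ T_xM` (`k` copies) of the bundle of `k¹`-velocities. -/
def VelocitySpace (x : M) : Type _ := Fin k → TangentSpace 𝓘(ℝ, E) x

instance (x : M) : AddCommGroup (VelocitySpace E k x) :=
  inferInstanceAs (AddCommGroup (Fin k → TangentSpace 𝓘(ℝ, E) x))

instance (x : M) : Module ℝ (VelocitySpace E k x) :=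
  inferInstanceAs (Module ℝ (Fin k → TangentSpace 𝓘(ℝ, E) x))

instance (x : M) : TopologicalSpace (VelocitySpace E k x) :=
  inferInstanceAs (TopologicalSpace (Fin k → TangentSpace 𝓘(ℝ, E) x))

variable (M)

/-- The bundle of `k¹`-velocities `T¹ₖM = TM ⊕ ⋯ ⊕ TM` (`k` copies). A point is a pair `⟨x, v⟩`
with `x : M` and `v = (v₁, …, vₖ)` a family of `k` tangent vectors at `x`. -/
abbrev VelocityBundle : Type _ :=
  Bundle.TotalSpace (Fin k → E) (VelocitySpace E k : M → Type _)

instance [IsManifold 𝓘(ℝ, E) 1 M] : TopologicalSpace (VelocityBundle E k M) :=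
  inferInstanceAs (TopologicalSpace (velocityCore E k M).TotalSpace)

instance [IsManifold 𝓘(ℝ, E) 1 M] :
    FiberBundle (Fin k → E) (VelocitySpace E k : M → Type _) :=
  inferInstanceAs (FiberBundle (Fin k → E) (velocityCore E k M).Fiber)

instance [IsManifold 𝓘(ℝ, E) 1 M] :
    VectorBundle ℝ (Fin k → E) (VelocitySpace E k : M → Type _) :=
  inferInstanceAs (VectorBundle ℝ (Fin k → E) (velocityCore E k M).Fiber)

instance [IsManifold 𝓘(ℝ, E) ∞ M] :
    ContMDiffVectorBundle ∞ (Fin k → E) (VelocitySpace E k : M → Type _) 𝓘(ℝ, E) :=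
  inferInstanceAs (ContMDiffVectorBundle ∞ (Fin k → E) (velocityCore E k M).Fiber 𝓘(ℝ, E))

end VelocityBundle

section Action

variable {k : ℕ}
  {E : Type*} [NormedAddCommGroup E] [NormedSpace ℝ E]
  {EG : Type*} [NormedAddCommGroup EG] [NormedSpace ℝ EG]
  {Q : Type*} [TopologicalSpace Q] [ChartedSpace E Q]
  {G : Type*} [Group G] [TopologicalSpace G] [ChartedSpace EG G]

/-- The adjoint action `Ad_g : 𝔤 → 𝔤`, the derivative at `1` of `h ↦ g h g⁻¹`. Here `𝔤 = T₁G`, whose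
underlying vector space is the model space `EG` of `G`. -/
def Ad (g : G) : EG →L[ℝ] EG :=
  (mfderiv 𝓘(ℝ, EG) 𝓘(ℝ, EG) (fun h : G => g * h * g⁻¹) 1 :)

theorem Ad_one : Ad (EG := EG) (1 : G) = ContinuousLinearMap.id ℝ EG := by
  have h : (fun h : G => (1 : G) * h * (1 : G)⁻¹) = id := by funext h; simp
  unfold Ad
  rw [h]
  exact mfderiv_id

theorem Ad_mul [LieGroup 𝓘(ℝ, EG) ∞ G] (g g' : G) :
    Ad (EG := EG) (g * g') = (Ad (EG := EG) g).comp (Ad (EG := EG) g') := by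
  have hs : ∀ g : G, ContMDiff 𝓘(ℝ, EG) 𝓘(ℝ, EG) ∞ (fun h : G => g * h * g⁻¹) := fun g =>
    (contMDiff_const.mul contMDiff_id).mul contMDiff_const
  have hd : ∀ g x : G, MDifferentiableAt 𝓘(ℝ, EG) 𝓘(ℝ, EG) (fun h : G => g * h * g⁻¹) x :=
    fun g x => (hs g).mdifferentiable (by simp) x
  have h : (fun h : G => (g * g') * h * (g * g')⁻¹)
      = (fun h : G => g * h * g⁻¹) ∘ (fun h : G => g' * h * g'⁻¹) := by
    funext h; simp [mul_assoc]
  have h1 : g' * 1 * g'⁻¹ = 1 := by simp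
  unfold Ad
  rw [h, mfderiv_comp (1 : G) (hd g _) (hd g' _), h1]
  rfl

/-- The isotropy group `G_μ` of `μ = (μ₁, …, μₖ) ∈ 𝔤* × ⋯ × 𝔤*` under the `k`-coadjoint action
`g · μ = (Ad_{g⁻¹}^* μ₁, …, Ad_{g⁻¹}^* μₖ)`. -/
def isotropy [LieGroup 𝓘(ℝ, EG) ∞ G] (μ : Fin k → EG →L[ℝ] ℝ) : Subgroup G where
  carrier := {g | ∀ a, (μ a).comp (Ad (EG := EG) g⁻¹) = μ a}
  one_mem' a := by
    rw [inv_one, Ad_one]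
    rfl
  mul_mem' {g g'} hg hg' a := by
    have h := hg' a
    have h' := hg a
    rw [mul_inv_rev, Ad_mul, ← ContinuousLinearMap.comp_assoc, h, h']
  inv_mem' {g} hg a := by
    have h := hg a
    rw [inv_inv]
    nth_rewrite 1 [← h]
    rw [ContinuousLinearMap.comp_assoc, ← Ad_mul, inv_mul_cancel, Ad_one]
    rfl

variable [MulAction G Q]

variable (G E EG) in
/-- The map `𝔤 → T_qQ`, `ξ ↦ ξ_Q(q)`, where `ξ_Q` is the infinitesimal generator of the action
corresponding to `ξ`: the derivative at `1` of the orbit map `g ↦ g · q`. -/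
def generator (q : Q) : EG →L[ℝ] TangentSpace 𝓘(ℝ, E) q :=
  (mfderiv 𝓘(ℝ, EG) 𝓘(ℝ, E) (fun g : G => g • q) 1 :)

/-- The prolonged action `g · (v₁, …, vₖ) = (T_qΦ_g(v₁), …, T_qΦ_g(vₖ))` of `G` on `T¹ₖQ`. -/
def prolong (g : G) (v : VelocityBundle E k Q) : VelocityBundle E k Q :=
  ⟨g • v.proj, fun a => mfderiv 𝓘(ℝ, E) 𝓘(ℝ, E) (fun q : Q => g • q) v.proj (v.snd a)⟩

theorem velocity_ext {q q' : Q} (h : q = q') {v v' : Fin k → E} (hv : v = v') :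
    (⟨q, v⟩ : VelocityBundle E k Q) = ⟨q', v'⟩ := by
  subst h hv
  rfl

theorem prolong_one {G : Type*} [Group G] [MulAction G Q] (v : VelocityBundle E k Q) : prolong (1 : G) v = v := by
  have h : (fun q : Q => (1 : G) • q) = id := by funext q; simp
  refine velocity_ext (E := E) (one_smul G v.proj) ?_
  funext a
  rw [h]
  exact congrArg (fun A : TangentSpace 𝓘(ℝ, E) v.proj →L[ℝ] TangentSpace 𝓘(ℝ, E) v.proj =>
    A (v.snd a)) mfderiv_id

variable (EG) in
theorem prolong_mul [ContMDiffSMul 𝓘(ℝ, EG) 𝓘(ℝ, E) ∞ G Q] (g g' : G)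
    (v : VelocityBundle E k Q) : prolong (g * g') v = prolong g (prolong g' v) := by
  have hd : ∀ (g : G) (x : Q), MDifferentiableAt 𝓘(ℝ, E) 𝓘(ℝ, E) (fun q : Q => g • q) x := by
    intro g x
    have : ContMDiff 𝓘(ℝ, E) 𝓘(ℝ, E) ∞ (fun q : Q => g • q) :=
      (contMDiff_smul (I := 𝓘(ℝ, EG)) (I' := 𝓘(ℝ, E)) (G := G) (M := Q)).comp
        (contMDiff_const.prodMk contMDiff_id)
    exact this.mdifferentiable (by simp) x
  have h : (fun q : Q => (g * g') • q) = (fun q : Q => g • q) ∘ (fun q : Q => g' • q) := by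
    funext q; simp [mul_smul]
  refine velocity_ext (E := E) (mul_smul g g' v.proj) ?_
  funext a
  rw [h, mfderiv_comp v.proj (hd g _) (hd g' _)]
  rfl

/-- The `a`-th component of the Legendre transformation at `v ∈ T¹ₖQ`: the covector
`w ↦ d/ds|₀ L(v₁, …, v_a + s w, …, vₖ)` at `q`, i.e. the derivative of `L` with respect to its
`a`-th velocity. -/
def legendre (L : VelocityBundle E k Q → ℝ) (v : VelocityBundle E k Q) (a : Fin k) :
    TangentSpace 𝓘(ℝ, E) v.proj →L[ℝ] ℝ :=
  fderiv ℝ (fun w : TangentSpace 𝓘(ℝ, E) v.proj => L ⟨v.proj, Function.update v.snd a w⟩) (v.snd a)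

variable (G EG) in
/-- The momentum map `J_L : T¹ₖQ → 𝔤* × ⋯ × 𝔤*` of a Lagrangian `L`, with components
`⟨J_L^a(v), ξ⟩ = ⟨(FL)^a(v), ξ_Q(q)⟩`. -/
def momentum (L : VelocityBundle E k Q → ℝ) (v : VelocityBundle E k Q) :
    Fin k → EG →L[ℝ] ℝ :=
  fun a => (legendre L v a).comp (generator E EG G v.proj)

variable (G EG) in
/-- The translation `v ↦ v + ξ_Q(q)` of `v ∈ T¹ₖQ` by `ξ = (ξ₁, …, ξₖ) ∈ 𝔤 × ⋯ × 𝔤`. -/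
def translate (v : VelocityBundle E k Q) (ξ : Fin k → EG) : VelocityBundle E k Q :=
  ⟨v.proj, fun a => v.snd a + generator E EG G v.proj (ξ a)⟩

variable (G EG) in
/-- `L` is `G`-regular if for every `v ∈ T¹ₖQ` the map `ξ ↦ J_L(v + ξ_Q(q))` is a diffeomorphism
from `𝔤 × ⋯ × 𝔤` onto `𝔤* × ⋯ × 𝔤*`. -/
def IsGRegular (L : VelocityBundle E k Q → ℝ) : Prop :=
  ∀ v : VelocityBundle E k Q,
    ∃ Ψ : (Fin k → EG) ≃ₘ^∞⟮𝓘(ℝ, Fin k → EG), 𝓘(ℝ, Fin k → EG →L[ℝ] ℝ)⟯ (Fin k → EG →L[ℝ] ℝ),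
      ∀ ξ, Ψ ξ = momentum EG G L (translate EG G v ξ)

end Action

section Orbits

/-- The space `X/H` of orbits of an action of `H` on `X`, with the quotient topology. -/
abbrev OrbitSpace (H X : Type*) [Group H] [MulAction H X] : Type _ :=
  Quotient (MulAction.orbitRel H X)

/-- The projection `X → X/H`. -/
def toOrbit (H : Type*) {X : Type*} [Group H] [MulAction H X] (x : X) : OrbitSpace H X :=
  Quotient.mk _ x

variable {G : Type*} [Group G] {Q : Type*} [TopologicalSpace Q] [MulAction G Q]

/-- For a subgroup `H` of `G`, the canonical (continuous) map `Q/H → Q/G`, `[q]_H ↦ [q]`. -/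
def orbitMap (Q : Type*) [TopologicalSpace Q] [MulAction G Q] (H : Subgroup G) :
    C(OrbitSpace H Q, OrbitSpace G Q) where
  toFun := Quotient.lift (toOrbit G) (by
    rintro a b ⟨g, hg⟩
    exact Quotient.sound ⟨g, hg⟩)
  continuous_toFun := continuous_quot_mk.quotient_lift _

@[simp] theorem orbitMap_toOrbit (H : Subgroup G) (q : Q) :
    orbitMap Q H (toOrbit H q) = toOrbit G q := rfl

end Orbits

section Reduced

variable {k : ℕ}
  {E : Type*} [NormedAddCommGroup E] [NormedSpace ℝ E]
  {EG : Type*} [NormedAddCommGroup EG] [NormedSpace ℝ EG]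
  {Q : Type*} [TopologicalSpace Q] [ChartedSpace E Q]
  {G : Type*} [Group G] [TopologicalSpace G] [ChartedSpace EG G]
  [LieGroup 𝓘(ℝ, EG) ∞ G] [MulAction G Q]

variable (G) in
/-- The level set `J_L⁻¹(μ)` in `T¹ₖQ`. -/
def levelSet (L : VelocityBundle E k Q → ℝ) (μ : Fin k → EG →L[ℝ] ℝ) :
    Set (VelocityBundle E k Q) :=
  {v | momentum EG G L v = μ}

variable [ContMDiffSMul 𝓘(ℝ, EG) 𝓘(ℝ, E) ∞ G Q]

variable (G) in
/-- Two points of `J_L⁻¹(μ)` are equivalent if the prolonged action of some `g ∈ G_μ` maps one to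
the other. -/
def levelSetoid (L : VelocityBundle E k Q → ℝ) (μ : Fin k → EG →L[ℝ] ℝ) :
    Setoid (levelSet G L μ) where
  r v w := ∃ g ∈ isotropy (G := G) μ, prolong g (v : VelocityBundle E k Q) = w
  iseqv :=
    { refl := fun v => ⟨1, one_mem _, prolong_one _⟩
      symm := by
        rintro v w ⟨g, hg, h⟩
        refine ⟨g⁻¹, inv_mem hg, ?_⟩
        rw [← h, ← prolong_mul EG, inv_mul_cancel, prolong_one]
      trans := by
        rintro u v w ⟨g, hg, h⟩ ⟨g', hg', h'⟩
        refine ⟨g' * g, mul_mem hg' hg, ?_⟩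
        rw [prolong_mul EG, h, h'] }

variable (G) in
/-- The Lagrangian reduced space `J_L⁻¹(μ)/G_μ`; its topology is the quotient of the subspace
topology of `J_L⁻¹(μ)`. -/
abbrev ReducedSpace (L : VelocityBundle E k Q → ℝ) (μ : Fin k → EG →L[ℝ] ℝ) : Type _ :=
  Quotient (levelSetoid G L μ)

variable (G) in
/-- The projection `J_L⁻¹(μ) → J_L⁻¹(μ)/G_μ`. -/
def toReduced (L : VelocityBundle E k Q → ℝ) (μ : Fin k → EG →L[ℝ] ℝ) (v : levelSet G L μ) :
    ReducedSpace G L μ :=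
  Quotient.mk _ v

variable (G) in
/-- The map `J_L⁻¹(μ)/G_μ → Q/G_μ` sending the class of `v` at `q` to `[q]_μ`. -/
def reducedBase (L : VelocityBundle E k Q → ℝ) (μ : Fin k → EG →L[ℝ] ℝ) :
    ReducedSpace G L μ → OrbitSpace (isotropy (G := G) μ) Q :=
  Quotient.lift (fun v => toOrbit _ v.1.proj) (by
    rintro v w ⟨g, hg, h⟩
    refine (Quotient.sound (MulAction.orbitRel_apply.2 ⟨⟨g, hg⟩, ?_⟩)).symm
    rw [← h]
    rfl)

end Reduced

end PolyRouth

end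

/-! The proof rests on one global splitting. Send `v` over `q` to `((q, Tπ v₁, …, Tπ vₖ), J_L(v))`,
a map from `T¹ₖQ` to `(Q ×_{Q/G} T¹ₖ(Q/G)) × (𝔤*)^k`. Over a fixed `q`, the velocities with given
image under `Tπ` form an affine space modelled on `k` copies of `ker T_qπ`. If that kernel is the
space of generators `ξ_Q(q)`, then `G`-regularity says exactly that `J_L` maps each such affine
space diffeomorphically onto `(𝔤*)^k`. So the splitting is bijective (`splitting_bijective`), its
fibre derivative is invertible (`exists_fiberwise_derivative_equiv`), and the inverse function
theorem makes it a diffeomorphism (`exists_splitting_diffeomorph`).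

The level set `J_L⁻¹(μ)` is then the slice over `μ`: an embedded submanifold diffeomorphic to `Q
×_{Q/G} T¹ₖ(Q/G)` (`exists_levelSet_structure`). Since `J_L` is equivariant (`momentum_prolong`),
`G_μ` preserves it, and since `π` is invariant, `G_μ` acts on the slice through `q` alone. Passing
to orbits replaces `Q` by `Q/G_μ` and leaves the velocities of `Q/G` untouched (`toReduced_eq_iff`,
`exists_reducedSpace_homeomorph`).

That generators fill `ker T_qπ` (`exists_generator_eq`) is a dimension count. They lie in the kernel
because `π` is constant on orbits, and `ξ ↦ ξ_Q(q)` is injective by `G`-regularity. The remaining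
bound, that fibres of `π` have dimension at most `dim 𝔤`, holds because such a fibre is locally a
smooth image of a ball in `𝔤` (`finrank_complement_le_of_free`). -/

noncomputable section

namespace PolyRouth

open scoped Topology
open Set Filter

set_option linter.unusedSectionVars false

/-! ### Derivatives on `k`-fold products -/

section LinearAlgebra

variable {E E' F : Type*} [NormedAddCommGroup E] [NormedSpace ℝ E]
  [NormedAddCommGroup E'] [NormedSpace ℝ E'] [NormedAddCommGroup F] [NormedSpace ℝ F] {k : ℕ}

variable (k) in
/-- The map `A × ⋯ × A : E^k → E'^k` induced by a continuous linear map `A : E → E'`. -/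
def kfold (A : E →L[ℝ] E') : (Fin k → E) →L[ℝ] (Fin k → E') :=
  ContinuousLinearMap.pi fun a => A.comp (ContinuousLinearMap.proj a)

@[simp] theorem kfold_apply (A : E →L[ℝ] E') (v : Fin k → E) (a : Fin k) :
    kfold k A v a = A (v a) := rfl

theorem kfold_single (A : E →L[ℝ] E') (a : Fin k) (w : E) :
    kfold k A (Pi.single a w) = Pi.single a (A w) := by
  funext b
  rw [kfold_apply]
  by_cases h : b = a
  · subst h; simp
  · simp [h]

theorem hasFDerivAt_comp_add_kfold {f : (Fin k → E') → F} {f' : (Fin k → E') →L[ℝ] F}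
    {v : Fin k → E'} (hf : HasFDerivAt f f' v) (A : E →L[ℝ] E') :
    HasFDerivAt (fun ξ : Fin k → E => f fun a => v a + A (ξ a)) (f'.comp (kfold k A)) 0 := by
  have hu : HasFDerivAt (fun ξ : Fin k → E => v + kfold k A ξ) (kfold k A) 0 :=
    (kfold k A).hasFDerivAt.const_add v
  have hf' : HasFDerivAt f f' (v + kfold k A 0) := by simpa using hf
  exact hf'.comp (0 : Fin k → E) hu

theorem fderiv_update_apply {f : (Fin k → E') → F} (hf : Differentiable ℝ f) (v : Fin k → E')
    (a : Fin k) (w : E') :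
    fderiv ℝ (fun w : E' => f (Function.update v a w)) (v a) w
      = fderiv ℝ f v (Pi.single a w) := by
  have hu := hasFDerivAt_update (𝕜 := ℝ) v (i := a) (v a)
  have hf' : HasFDerivAt f (fderiv ℝ f v) (Function.update v a (v a)) := by
    rw [Function.update_eq_self]; exact (hf v).hasFDerivAt
  have h := hf'.comp (v a) hu
  rw [show (fun w : E' => f (Function.update v a w)) = f ∘ Function.update v a from rfl, h.fderiv,
    ContinuousLinearMap.comp_apply]
  congr 1
  funext b
  by_cases hb : b = a
  · subst hb; simp
  · simp [hb]

end LinearAlgebra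

/-! ### Smooth maps into velocity bundles and their pullbacks -/

section Basics

variable {k : ℕ}
  {E : Type*} [NormedAddCommGroup E] [NormedSpace ℝ E]
  {M : Type*} [TopologicalSpace M] [ChartedSpace E M] [IsManifold 𝓘(ℝ, E) ∞ M]
  {E' : Type*} [NormedAddCommGroup E'] [NormedSpace ℝ E']
  {M' : Type*} [TopologicalSpace M'] [ChartedSpace E' M'] [IsManifold 𝓘(ℝ, E') ∞ M']
  {EX HX : Type*} [NormedAddCommGroup EX] [NormedSpace ℝ EX] [TopologicalSpace HX]
  {IX : ModelWithCorners ℝ EX HX}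
  {X : Type*} [TopologicalSpace X] [ChartedSpace HX X]

theorem velocity_trivializationAt_apply (x₀ : M) (z : VelocityBundle E k M) (a : Fin k) :
    (trivializationAt (Fin k → E) (VelocitySpace E k : M → Type _) x₀ z).2 a
      = tangentCoordChange 𝓘(ℝ, E) z.proj x₀ z.proj (z.snd a) := by
  exact diag_apply (tangentCoordChange 𝓘(ℝ, E) z.proj x₀ z.proj) z.snd a

theorem velocity_trivializationAt_apply_eq (x₀ : M) (z : VelocityBundle E k M) (a : Fin k) :
    (trivializationAt (Fin k → E) (VelocitySpace E k : M → Type _) x₀ z).2 a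
      = (trivializationAt E (TangentSpace 𝓘(ℝ, E) : M → Type _) x₀ ⟨z.proj, z.snd a⟩).2 := by
  rw [velocity_trivializationAt_apply]
  rfl

/-- The trivializations of `T¹ₖM` are those of `TM` in each component, so smoothness can be tested
one tangent vector at a time. This reduces smoothness questions about `T¹ₖM` to known facts on the
tangent bundle. -/
theorem contMDiffAt_velocity_iff {g : X → VelocityBundle E k M} {x : X} :
    ContMDiffAt IX (𝓘(ℝ, E).prod 𝓘(ℝ, Fin k → E)) ∞ g x ↔
      ContMDiffAt IX 𝓘(ℝ, E) ∞ (fun y => (g y).proj) x ∧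
      ∀ a, ContMDiffAt IX 𝓘(ℝ, E).tangent ∞
        (fun y => (⟨(g y).proj, (g y).snd a⟩ : TangentBundle 𝓘(ℝ, E) M)) x := by
  simp only [Bundle.contMDiffAt_totalSpace]
  constructor
  · rintro ⟨h, h'⟩
    refine ⟨h, fun a => ⟨h, ?_⟩⟩
    refine (contMDiffAt_pi_space.1 h' a).congr_of_eventuallyEq (.of_forall fun y => ?_)
    exact (velocity_trivializationAt_apply_eq _ _ _).symm
  · rintro ⟨h, h'⟩
    refine ⟨h, contMDiffAt_pi_space.2 fun a => ?_⟩
    refine (h' a).2.congr_of_eventuallyEq (.of_forall fun y => ?_)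
    exact velocity_trivializationAt_apply_eq _ _ _

theorem contMDiff_velocity_iff {g : X → VelocityBundle E k M} :
    ContMDiff IX (𝓘(ℝ, E).prod 𝓘(ℝ, Fin k → E)) ∞ g ↔
      ContMDiff IX 𝓘(ℝ, E) ∞ (fun y => (g y).proj) ∧
      ∀ a, ContMDiff IX 𝓘(ℝ, E).tangent ∞
        (fun y => (⟨(g y).proj, (g y).snd a⟩ : TangentBundle 𝓘(ℝ, E) M)) := by
  simp only [ContMDiff, contMDiffAt_velocity_iff]
  exact ⟨fun h => ⟨fun x => (h x).1, fun a x => (h x).2 a⟩, fun h x => ⟨h.1 x, fun a => h.2 a x⟩⟩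

/-- The `k`-fold tangent map `T¹ₖf : T¹ₖM → T¹ₖM'`. -/
def velocityMap (f : M → M') (v : VelocityBundle E k M) : VelocityBundle E' k M' :=
  ⟨f v.proj, fun a => mfderiv 𝓘(ℝ, E) 𝓘(ℝ, E') f v.proj (v.snd a)⟩

theorem contMDiff_velocity_proj :
    ContMDiff (𝓘(ℝ, E).prod 𝓘(ℝ, Fin k → E)) 𝓘(ℝ, E) ∞
      (fun v : VelocityBundle E k M => v.proj) :=
  Bundle.contMDiff_proj _

theorem contMDiff_velocity_component (a : Fin k) :
    ContMDiff (𝓘(ℝ, E).prod 𝓘(ℝ, Fin k → E)) 𝓘(ℝ, E).tangent ∞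
      (fun v : VelocityBundle E k M => (⟨v.proj, v.snd a⟩ : TangentBundle 𝓘(ℝ, E) M)) :=
  (contMDiff_velocity_iff.1 contMDiff_id).2 a

theorem contMDiff_velocityMap {f : M → M'} (hf : ContMDiff 𝓘(ℝ, E) 𝓘(ℝ, E') ∞ f) :
    ContMDiff (𝓘(ℝ, E).prod 𝓘(ℝ, Fin k → E)) (𝓘(ℝ, E').prod 𝓘(ℝ, Fin k → E')) ∞
      (velocityMap f : VelocityBundle E k M → VelocityBundle E' k M') := by
  have ht : ContMDiff 𝓘(ℝ, E).tangent 𝓘(ℝ, E').tangent ∞ (tangentMap 𝓘(ℝ, E) 𝓘(ℝ, E') f) :=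
    hf.contMDiff_tangentMap (by simp)
  exact contMDiff_velocity_iff.2 ⟨hf.comp contMDiff_velocity_proj,
    fun a => ht.comp (contMDiff_velocity_component a)⟩

theorem contMDiffAt_tangent_add {p : X → M} {u w : ∀ x : X, TangentSpace 𝓘(ℝ, E) (p x)} {x : X}
    (hu : ContMDiffAt IX 𝓘(ℝ, E).tangent ∞ (fun y => (⟨p y, u y⟩ : TangentBundle 𝓘(ℝ, E) M)) x)
    (hw : ContMDiffAt IX 𝓘(ℝ, E).tangent ∞ (fun y => (⟨p y, w y⟩ : TangentBundle 𝓘(ℝ, E) M)) x) :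
    ContMDiffAt IX 𝓘(ℝ, E).tangent ∞
      (fun y => (⟨p y, u y + w y⟩ : TangentBundle 𝓘(ℝ, E) M)) x := by
  simp only [Bundle.contMDiffAt_totalSpace] at hu hw ⊢
  refine ⟨hu.1, (hu.2.add hw.2).congr_of_eventuallyEq (.of_forall fun y => ?_)⟩
  exact map_add (tangentCoordChange 𝓘(ℝ, E) (p y) (p x) (p y)) (u y) (w y)

/-- The inclusion of a fibre of `T¹ₖM` is smooth. -/
theorem contMDiff_fiber (q : M) :
    ContMDiff 𝓘(ℝ, Fin k → E) (𝓘(ℝ, E).prod 𝓘(ℝ, Fin k → E)) ∞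
      (fun v : Fin k → E => (⟨q, v⟩ : VelocityBundle E k M)) := by
  intro v
  rw [Bundle.contMDiffAt_totalSpace]
  refine ⟨contMDiffAt_const, ?_⟩
  exact (diag E k (tangentCoordChange 𝓘(ℝ, E) q q q)).contMDiff.contMDiffAt

variable {p : C(X, M)}

/-- The pullback bundle uses the trivializations of `T¹ₖM` at `p x`, so the fibre coordinates on
both sides coincide. Smoothness of `p` only supplies the base component of the map to `T¹ₖM`. -/
theorem contMDiffAt_pullback_iff {Y EY HY : Type*} [NormedAddCommGroup EY] [NormedSpace ℝ EY]
    [TopologicalSpace HY] {IY : ModelWithCorners ℝ EY HY} [TopologicalSpace Y] [ChartedSpace HY Y]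
    {g : Y → Bundle.TotalSpace (Fin k → E) (p *ᵖ (VelocitySpace E k : M → Type _))} {y : Y}
    (hp : ContMDiffAt IX 𝓘(ℝ, E) ∞ p (g y).proj) :
    ContMDiffAt IY (IX.prod 𝓘(ℝ, Fin k → E)) ∞ g y ↔
      ContMDiffAt IY IX ∞ (fun z => (g z).proj) y ∧
      ContMDiffAt IY (𝓘(ℝ, E).prod 𝓘(ℝ, Fin k → E)) ∞
        (fun z => (⟨p (g z).proj, (g z).snd⟩ : VelocityBundle E k M)) y := by
  rw [Bundle.contMDiffAt_totalSpace, Bundle.contMDiffAt_totalSpace]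
  constructor
  · rintro ⟨h, h'⟩
    exact ⟨h, hp.comp (f := fun z => (g z).proj) y h, h'⟩
  · rintro ⟨h, h', h''⟩
    exact ⟨h, h''⟩

end Basics

/-! ### Smoothness of generators, translations and the momentum map -/

section SmoothSMul

variable {E : Type*} [NormedAddCommGroup E] [NormedSpace ℝ E]
  {Q : Type*} [TopologicalSpace Q] [ChartedSpace E Q]
  (EG : Type*) [NormedAddCommGroup EG] [NormedSpace ℝ EG]
  {G : Type*} [Group G] [TopologicalSpace G] [ChartedSpace EG G] [MulAction G Q]

theorem contMDiff_smul_const [ContMDiffSMul 𝓘(ℝ, EG) 𝓘(ℝ, E) ∞ G Q] (q : Q) :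
    ContMDiff 𝓘(ℝ, EG) 𝓘(ℝ, E) ∞ (fun g : G => g • q) :=
  (contMDiff_smul (I := 𝓘(ℝ, EG)) (I' := 𝓘(ℝ, E)) (G := G) (M := Q)).comp
    (contMDiff_id.prodMk contMDiff_const)

theorem contMDiff_const_smul [ContMDiffSMul 𝓘(ℝ, EG) 𝓘(ℝ, E) ∞ G Q] (g : G) :
    ContMDiff 𝓘(ℝ, E) 𝓘(ℝ, E) ∞ (fun q : Q => g • q) :=
  (contMDiff_smul (I := 𝓘(ℝ, EG)) (I' := 𝓘(ℝ, E)) (G := G) (M := Q)).comp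
    (contMDiff_const.prodMk contMDiff_id)

end SmoothSMul

section ActionSmooth

variable {k : ℕ}
  {E : Type*} [NormedAddCommGroup E] [NormedSpace ℝ E]
  {EG : Type*} [NormedAddCommGroup EG] [NormedSpace ℝ EG]
  {Q : Type*} [TopologicalSpace Q] [ChartedSpace E Q] [IsManifold 𝓘(ℝ, E) ∞ Q]
  {G : Type*} [Group G] [TopologicalSpace G] [ChartedSpace EG G] [LieGroup 𝓘(ℝ, EG) ∞ G]
  [MulAction G Q] [ContMDiffSMul 𝓘(ℝ, EG) 𝓘(ℝ, E) ∞ G Q]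

/-- The generator is the partial derivative in `g`, at `g = 1`, of the jointly smooth action, and
partial derivatives of smooth maps depend smoothly on parameters. -/
theorem contMDiff_generator :
    ContMDiff (𝓘(ℝ, E).prod 𝓘(ℝ, EG)) 𝓘(ℝ, E).tangent ∞
      (fun z : Q × EG => (⟨z.1, generator E EG G z.1 z.2⟩ : TangentBundle 𝓘(ℝ, E) Q)) := by
  intro z₀
  have : IsManifold 𝓘(ℝ, EG) ∞ G := inferInstance
  have hs : ContMDiff (𝓘(ℝ, E).prod 𝓘(ℝ, EG)) 𝓘(ℝ, E) ∞
      (Function.uncurry fun (q : Q) (g : G) => g • q) :=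
    (contMDiff_smul (I := 𝓘(ℝ, EG)) (I' := 𝓘(ℝ, E)) (G := G) (M := Q)).comp
      (contMDiff_snd.prodMk contMDiff_fst)
  have h := ContMDiffAt.mfderiv_apply (I := 𝓘(ℝ, EG)) (I' := 𝓘(ℝ, E)) (J := 𝓘(ℝ, E))
    (J' := 𝓘(ℝ, E).prod 𝓘(ℝ, EG)) (m := ∞) (n := ∞) (x₀ := z₀)
    (fun (q : Q) (g : G) => g • q) (fun _ => 1) (Prod.fst : Q × EG → Q) Prod.snd
    hs.contMDiffAt contMDiffAt_const contMDiffAt_fst contMDiffAt_snd (by simp)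
  rw [Bundle.contMDiffAt_totalSpace]
  refine ⟨contMDiffAt_fst, h.congr_of_eventuallyEq ?_⟩
  have hev : ∀ᶠ z : Q × EG in 𝓝 z₀, z.1 ∈ (chartAt E z₀.1).source :=
    continuous_fst.continuousAt.eventually ((chartAt E z₀.1).open_source.mem_nhds
      (mem_chart_source E z₀.1))
  filter_upwards [hev] with z hz
  refine Eq.trans ?_ (DFunLike.congr_fun (inTangentCoordinates_eq (I := 𝓘(ℝ, EG))
    (I' := 𝓘(ℝ, E)) (fun _ : Q => (1 : G)) (fun q : Q => (1 : G) • q) (generator E EG G)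
    (x₀ := z₀.1) (x := z.1) (mem_chart_source _ _) (by simpa using hz)) z.2).symm
  -- On the group side the base point is always `1`, so the coordinate change there is the identity;
  -- only `1 • q = q` is left to reconcile.
  have h2 : tangentCoordChange 𝓘(ℝ, EG) (1 : G) 1 1 z.2 = z.2 :=
    tangentCoordChange_self (I := 𝓘(ℝ, EG)) (by simp)
  change _ = tangentCoordChange 𝓘(ℝ, E) _ _ _
    (generator E EG G z.1 (tangentCoordChange 𝓘(ℝ, EG) (1 : G) 1 1 z.2))
  rw [h2, one_smul, one_smul]
  rfl

theorem contMDiff_translate :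
    ContMDiff ((𝓘(ℝ, E).prod 𝓘(ℝ, Fin k → E)).prod 𝓘(ℝ, Fin k → EG))
      (𝓘(ℝ, E).prod 𝓘(ℝ, Fin k → E)) ∞
      (fun z : VelocityBundle E k Q × (Fin k → EG) => translate EG G z.1 z.2) := by
  have hp : ContMDiff ((𝓘(ℝ, E).prod 𝓘(ℝ, Fin k → E)).prod 𝓘(ℝ, Fin k → EG)) 𝓘(ℝ, E) ∞
      (fun z : VelocityBundle E k Q × (Fin k → EG) => z.1.proj) :=
    contMDiff_velocity_proj.comp contMDiff_fst
  refine contMDiff_velocity_iff.2 ⟨hp, fun a z => ?_⟩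
  have hξ : ContMDiff ((𝓘(ℝ, E).prod 𝓘(ℝ, Fin k → E)).prod 𝓘(ℝ, Fin k → EG)) 𝓘(ℝ, EG) ∞
      (fun z : VelocityBundle E k Q × (Fin k → EG) => z.2 a) :=
    (contMDiff_pi_space.1 contMDiff_id a).comp contMDiff_snd
  have h1 := (contMDiff_velocity_component (E := E) (M := Q) (k := k) a).comp
    (contMDiff_fst (M := VelocityBundle E k Q) (N := Fin k → EG) (J := 𝓘(ℝ, Fin k → EG)))
  have h2 := (contMDiff_generator (E := E) (EG := EG) (Q := Q) (G := G)).comp (hp.prodMk hξ)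
  exact contMDiffAt_tangent_add (h1 z) (h2 z)

/-- The derivative of `L` along the fibres of `T¹ₖQ`. -/
def fiberDeriv (L : VelocityBundle E k Q → ℝ) (v : VelocityBundle E k Q) :
    (Fin k → E) →L[ℝ] ℝ :=
  fderiv ℝ (fun w : Fin k → E => L ⟨v.proj, w⟩) v.snd

theorem differentiable_fiber {L : VelocityBundle E k Q → ℝ}
    (hL : ContMDiff (𝓘(ℝ, E).prod 𝓘(ℝ, Fin k → E)) 𝓘(ℝ, ℝ) ∞ L) (q : Q) :
    Differentiable ℝ (fun w : Fin k → E => L ⟨q, w⟩) :=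
  ((hL.comp (contMDiff_fiber q)).contDiff).differentiable (by simp)

theorem legendre_apply {L : VelocityBundle E k Q → ℝ}
    (hL : ContMDiff (𝓘(ℝ, E).prod 𝓘(ℝ, Fin k → E)) 𝓘(ℝ, ℝ) ∞ L) (v : VelocityBundle E k Q)
    (a : Fin k) (w : E) :
    legendre L v a w = fiberDeriv L v (Pi.single a w) :=
  fderiv_update_apply (differentiable_fiber hL v.proj) v.snd a w

theorem hasFDerivAt_translate {L : VelocityBundle E k Q → ℝ}
    (hL : ContMDiff (𝓘(ℝ, E).prod 𝓘(ℝ, Fin k → E)) 𝓘(ℝ, ℝ) ∞ L) (v : VelocityBundle E k Q) :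
    HasFDerivAt (fun ξ : Fin k → EG => L (translate EG G v ξ))
      ((fiberDeriv L v).comp (kfold k (generator E EG G v.proj : EG →L[ℝ] E))) 0 :=
  hasFDerivAt_comp_add_kfold (differentiable_fiber hL v.proj).differentiableAt.hasFDerivAt _

/-- All components of `J_L(v)` are read off a single derivative, at `0`, of a function on the fixed
space `𝔤^k`. In this form no tangent space of `Q` appears, and both smoothness and equivariance of
`J_L` become chain rule statements. -/
theorem momentum_apply {L : VelocityBundle E k Q → ℝ}
    (hL : ContMDiff (𝓘(ℝ, E).prod 𝓘(ℝ, Fin k → E)) 𝓘(ℝ, ℝ) ∞ L) (v : VelocityBundle E k Q)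
    (a : Fin k) (ξ : EG) :
    momentum EG G L v a ξ =
      fderiv ℝ (fun ξ : Fin k → EG => L (translate EG G v ξ)) 0 (Pi.single a ξ) := by
  rw [(hasFDerivAt_translate hL v).fderiv]
  refine (legendre_apply hL v a _).trans ?_
  exact congrArg (fiberDeriv L v)
    (kfold_single (E' := E) (generator E EG G v.proj) a ξ).symm

theorem contMDiff_momentum {L : VelocityBundle E k Q → ℝ}
    (hL : ContMDiff (𝓘(ℝ, E).prod 𝓘(ℝ, Fin k → E)) 𝓘(ℝ, ℝ) ∞ L) :
    ContMDiff (𝓘(ℝ, E).prod 𝓘(ℝ, Fin k → E)) 𝓘(ℝ, Fin k → EG →L[ℝ] ℝ) ∞ (momentum EG G L) := by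
  intro v₀
  have h := ContMDiffAt.mfderiv (I := 𝓘(ℝ, Fin k → EG)) (I' := 𝓘(ℝ, ℝ))
    (J := 𝓘(ℝ, E).prod 𝓘(ℝ, Fin k → E)) (m := ∞) (n := ∞) (x₀ := v₀)
    (fun (v : VelocityBundle E k Q) (ξ : Fin k → EG) => L (translate EG G v ξ)) (fun _ => 0)
    (hL.comp contMDiff_translate).contMDiffAt contMDiffAt_const (by simp)
  -- Source and target are vector spaces, so the derivative in tangent coordinates is the ordinary
  -- one.
  have he := inTangentCoordinates_model_space (I := 𝓘(ℝ, Fin k → EG)) (I' := 𝓘(ℝ, ℝ))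
    (fun _ : VelocityBundle E k Q => (0 : Fin k → EG)) (fun v => L (translate EG G v 0))
    (fun v => fderiv ℝ (fun ξ : Fin k → EG => L (translate EG G v ξ)) 0) v₀
  simp only [mfderiv_eq_fderiv] at h
  replace h := he ▸ h
  refine contMDiffAt_pi_space.2 fun a => ?_
  have h' := ((ContinuousLinearMap.compL ℝ EG (Fin k → EG) ℝ).flip
    (ContinuousLinearMap.single ℝ (fun _ : Fin k => EG) a)).contMDiff.contMDiffAt.comp v₀ h
  refine h'.congr_of_eventuallyEq (.of_forall fun v => ?_)
  ext ξ
  rw [momentum_apply hL]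
  rfl

end ActionSmooth

/-! ### Charts in arbitrary normed spaces, local sections, transport of structure -/

section VectorChart

variable {E : Type*} [NormedAddCommGroup E] [NormedSpace ℝ E]
  {H : Type*} [TopologicalSpace H] {I : ModelWithCorners ℝ E H}
  {M : Type*} [TopologicalSpace M] [ChartedSpace H M]
  {E' : Type*} [NormedAddCommGroup E'] [NormedSpace ℝ E']
  {H' : Type*} [TopologicalSpace H'] {J : ModelWithCorners ℝ E' H'}
  {N : Type*} [TopologicalSpace N] [ChartedSpace H' N]
  {V W F : Type*} [NormedAddCommGroup V] [NormedSpace ℝ V]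
  [NormedAddCommGroup W] [NormedSpace ℝ W] [NormedAddCommGroup F] [NormedSpace ℝ F]

variable (I) in
/-- A smooth chart of `M` with values in a normed space `V` that may differ from the model space. -/
structure IsVectorChart (φ : OpenPartialHomeomorph M V) : Prop where
  contMDiffOn : ContMDiffOn I 𝓘(ℝ, V) ∞ φ φ.source
  contMDiffOn_symm : ContMDiffOn 𝓘(ℝ, V) I ∞ φ.symm φ.target

namespace IsVectorChart

theorem of_mem_maximalAtlas [I.Boundaryless] [IsManifold I ∞ M] {e : OpenPartialHomeomorph M H}
    (he : e ∈ IsManifold.maximalAtlas I ∞ M) :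
    IsVectorChart I (e.transHomeomorph I.toHomeomorph) where
  contMDiffOn := I.contMDiff.comp_contMDiffOn (contMDiffOn_of_mem_maximalAtlas he)
  contMDiffOn_symm :=
    (contMDiffOn_symm_of_mem_maximalAtlas he).comp
      (I.contMDiffOn_symm.mono (by simp [I.range_eq_univ])) (fun x hx => hx)

theorem transHomeomorph_mem_maximalAtlas [I.Boundaryless] [IsManifold I ∞ M]
    {φ : OpenPartialHomeomorph M V} (hφ : IsVectorChart I φ) (ℓ : V ≃L[ℝ] E) :
    φ.transHomeomorph (ℓ.toHomeomorph.trans I.toHomeomorph.symm)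
      ∈ IsManifold.maximalAtlas I ∞ M := by
  refine OpenPartialHomeomorph.mem_maximalAtlas_of_contMDiffOn _ ?_ ?_
  · exact I.contMDiffOn_symm.comp (ℓ.contDiff.contMDiff.comp_contMDiffOn hφ.contMDiffOn)
      (fun _ _ => by rw [I.range_eq_univ]; trivial)
  · exact hφ.contMDiffOn_symm.comp
      (ℓ.symm.contDiff.contMDiff.comp I.contMDiff).contMDiffOn (fun _ hx => hx)

theorem diffeomorph_trans (D : N ≃ₘ^∞⟮J, I⟯ M) {φ : OpenPartialHomeomorph M V}
    (hφ : IsVectorChart I φ) :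
    IsVectorChart J (D.toHomeomorph.transOpenPartialHomeomorph φ) where
  contMDiffOn := hφ.contMDiffOn.comp D.contMDiff.contMDiffOn fun _ hx => hx
  contMDiffOn_symm := D.symm.contMDiff.comp_contMDiffOn hφ.contMDiffOn_symm

/-- A projection in vector charts is a projection in genuine charts once `ℓ` and `ℓ'` are absorbed
into the linear splitting. This allows the Euclidean model spaces of the final structures to be
ignored when local normal forms are checked. -/
theorem isSubmersionAtOfComplement [I.Boundaryless] [J.Boundaryless] [IsManifold I ∞ M]
    [IsManifold J ∞ N] {f : M → N} {x : M}
    {φ : OpenPartialHomeomorph M V} (hφ : IsVectorChart I φ)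
    {ψ : OpenPartialHomeomorph N W} (hψ : IsVectorChart J ψ) (ℓ : V ≃L[ℝ] E) (ℓ' : W ≃L[ℝ] E')
    (e : V ≃L[ℝ] (W × F)) (hx : x ∈ φ.source) (hfx : MapsTo f φ.source ψ.source)
    (h : ∀ y ∈ φ.source, ψ (f y) = (e (φ y)).1) :
    Manifold.IsSubmersionAtOfComplement F I J ∞ f x := by
  refine Manifold.IsSubmersionAtOfComplement.mk_of_charts
    (ℓ.symm.trans (e.trans (ℓ'.prodCongr (.refl ℝ F)))) _ _ hx (hfx hx)
    (hφ.transHomeomorph_mem_maximalAtlas ℓ) (hψ.transHomeomorph_mem_maximalAtlas ℓ') hfx ?_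
  intro y hy
  have hI : I (I.symm y) = y := I.right_inv (by simp [I.range_eq_univ])
  have hy' : ℓ.symm y ∈ φ.target := by
    simp only [mfld_simps] at hy
    simpa [hI] using hy.2
  have := h _ (φ.map_target hy')
  rw [φ.right_inv hy'] at this
  simp [I.range_eq_univ, J.range_eq_univ, this]

theorem isImmersionAtOfComplement [I.Boundaryless] [J.Boundaryless] [IsManifold I ∞ M]
    [IsManifold J ∞ N] {f : M → N} {x : M}
    {φ : OpenPartialHomeomorph M V} (hφ : IsVectorChart I φ)
    {ψ : OpenPartialHomeomorph N W} (hψ : IsVectorChart J ψ) (ℓ : V ≃L[ℝ] E) (ℓ' : W ≃L[ℝ] E')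
    (e : (V × F) ≃L[ℝ] W) (hx : x ∈ φ.source) (hfx : MapsTo f φ.source ψ.source)
    (h : ∀ y ∈ φ.source, ψ (f y) = e (φ y, 0)) :
    Manifold.IsImmersionAtOfComplement F I J ∞ f x := by
  refine Manifold.IsImmersionAtOfComplement.mk_of_charts
    ((ℓ.symm.prodCongr (.refl ℝ F)).trans (e.trans ℓ')) _ _ hx (hfx hx)
    (hφ.transHomeomorph_mem_maximalAtlas ℓ) (hψ.transHomeomorph_mem_maximalAtlas ℓ') hfx ?_
  intro y hy
  have hI : I (I.symm y) = y := I.right_inv (by simp [I.range_eq_univ])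
  have hy' : ℓ.symm y ∈ φ.target := by
    simp only [mfld_simps] at hy
    simpa [hI] using hy.2
  have := h _ (φ.map_target hy')
  rw [φ.right_inv hy'] at this
  simp [I.range_eq_univ, J.range_eq_univ, this]

end IsVectorChart

theorem IsSubmersionAtOfComplement.exists_vectorChart [I.Boundaryless] [J.Boundaryless]
    [IsManifold I ∞ M] [IsManifold J ∞ N] {f : M → N} {x : M}
    (hf : Manifold.IsSubmersionAtOfComplement F I J ∞ f x) :
    ∃ (φ : OpenPartialHomeomorph M E) (ψ : OpenPartialHomeomorph N E') (e : E ≃L[ℝ] (E' × F)),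
      IsVectorChart I φ ∧ IsVectorChart J ψ ∧ x ∈ φ.source ∧ MapsTo f φ.source ψ.source ∧
      ∀ y ∈ φ.source, ψ (f y) = (e (φ y)).1 := by
  refine ⟨hf.domChart.transHomeomorph I.toHomeomorph, hf.codChart.transHomeomorph J.toHomeomorph,
    hf.equiv, .of_mem_maximalAtlas hf.domChart_mem_maximalAtlas,
    .of_mem_maximalAtlas hf.codChart_mem_maximalAtlas, hf.mem_domChart_source,
    hf.source_subset_preimage_source, fun y hy => ?_⟩
  have hy' : y ∈ hf.domChart.source := hy
  have h := hf.writtenInCharts ((hf.domChart.extend I).map_source (x := y) (by simpa using hy'))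
  simpa [hf.domChart.left_inv hy'] using h

theorem IsSubmersionAtOfComplement.exists_section [I.Boundaryless] [J.Boundaryless]
    [IsManifold I ∞ M] [IsManifold J ∞ N] {f : M → N} {x : M}
    (hf : Manifold.IsSubmersionAtOfComplement F I J ∞ f x) :
    ∃ σ : N → M, ContMDiffAt J I ∞ σ (f x) ∧ σ (f x) = x ∧ ∀ᶠ z in 𝓝 (f x), f (σ z) = z := by
  obtain ⟨φ, ψ, e, hφ, hψ, hx, hm, h⟩ := IsSubmersionAtOfComplement.exists_vectorChart hf
  have hx0 : e.symm (ψ (f x), (e (φ x)).2) = φ x := by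
    rw [h x hx, Prod.mk.eta, e.symm_apply_apply]
  have hψx : ContMDiffAt J 𝓘(ℝ, E') ∞ ψ (f x) :=
    hψ.contMDiffOn.contMDiffAt (ψ.open_source.mem_nhds (hm hx))
  have h1 : ContMDiffAt J 𝓘(ℝ, E) ∞ (fun z => e.symm (ψ z, (e (φ x)).2)) (f x) := by
    have hlin : ContDiff ℝ ∞ (fun w : E' => e.symm (w, (e (φ x)).2)) :=
      e.symm.contDiff.comp (contDiff_id.prodMk contDiff_const)
    exact hlin.contMDiff.contMDiffAt.comp (f x) hψx
  -- In submersion charts the section freezes the `F`-coordinate at its value at `x`. It is a total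
  -- function, meaningful only near `f x`.
  refine ⟨fun z => φ.symm (e.symm (ψ z, (e (φ x)).2)), ?_, ?_, ?_⟩
  · refine ContMDiffAt.comp (f x) (I' := 𝓘(ℝ, E)) (g := φ.symm) ?_ h1
    rw [hx0]
    exact hφ.contMDiffOn_symm.contMDiffAt (φ.open_target.mem_nhds (φ.map_source hx))
  · simp only [hx0, φ.left_inv hx]
  · have h2 : ∀ᶠ z in 𝓝 (f x), e.symm (ψ z, (e (φ x)).2) ∈ φ.target :=
      h1.continuousAt.eventually (φ.open_target.mem_nhds (by
        simp only [hx0, φ.map_source hx]))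
    filter_upwards [h2, ψ.open_source.mem_nhds (hm hx)] with z hz hz'
    have hs := φ.map_target hz
    refine ψ.injOn (hm hs) hz' ?_
    rw [h _ hs, φ.right_inv hz, e.apply_symm_apply]

/-- The topology of `X` is already given (a subspace or a quotient), so a homeomorphism is what is
needed to pull the atlas back. The isomorphism `ℓ` moves the charts into the prescribed model space,
later a Euclidean one. -/
theorem exists_transport_structure [I.Boundaryless] [IsManifold I ∞ M] {X : Type*}
    [TopologicalSpace X] (h : X ≃ₜ M) (ℓ : E ≃L[ℝ] V) :
    ∃ (_ : ChartedSpace V X) (_ : IsManifold 𝓘(ℝ, V) ∞ X) (D : X ≃ₘ^∞⟮𝓘(ℝ, V), I⟯ M),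
      ∀ x, D x = h x := by
  let c : OpenPartialHomeomorph M H → OpenPartialHomeomorph X V := fun e =>
    h.transOpenPartialHomeomorph (e.transHomeomorph (I.toHomeomorph.trans ℓ.toHomeomorph))
  let cs : ChartedSpace V X :=
    { atlas := c '' atlas H M
      chartAt := fun x => c (chartAt H (h x))
      mem_chart_source := fun x => mem_chart_source H (h x)
      chart_mem_atlas := fun x => mem_image_of_mem _ (chart_mem_atlas H (h x)) }
  have hman : IsManifold 𝓘(ℝ, V) ∞ X := by
    refine isManifold_of_contDiffOn _ _ _ ?_
    rintro _ _ ⟨e, he, rfl⟩ ⟨e', he', rfl⟩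
    rw [← contMDiffOn_iff_contDiffOn]
    have h1 := contMDiffOn_symm_of_mem_maximalAtlas (I := I) (n := ∞)
      (IsManifold.subset_maximalAtlas he)
    have h2 := contMDiffOn_of_mem_maximalAtlas (I := I) (n := ∞)
      (IsManifold.subset_maximalAtlas he')
    have h3 : ContMDiff 𝓘(ℝ, V) I ∞ (fun v => I.symm (ℓ.symm v)) := by
      refine fun v => (I.contMDiffOn_symm.contMDiffAt (by simp [I.range_eq_univ])).comp v
        ℓ.symm.contDiff.contMDiff.contMDiffAt
    let S : Set V := (fun v => I.symm (ℓ.symm v)) ⁻¹' e.target ∩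
      (fun v => e.symm (I.symm (ℓ.symm v))) ⁻¹' e'.source
    have h4 := ((ℓ.contDiff (n := ∞)).contMDiff.comp I.contMDiff).comp_contMDiffOn
      (h2.comp (h1.comp (h3.contMDiffOn (s := S)) (fun v hv => hv.1)) (fun v hv => hv.2))
    refine (h4.mono ?_).congr ?_
    · intro v hv
      simpa [c, S] using hv
    · intro v hv
      simp [c]
  have hD : ContMDiff 𝓘(ℝ, V) I ∞ h := by
    intro x
    have h1 : ContMDiffAt 𝓘(ℝ, V) 𝓘(ℝ, V) ∞ (c (chartAt H (h x))) x :=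
      contMDiffOn_chart.contMDiffAt ((chartAt V x).open_source.mem_nhds (mem_chart_source V x))
    have h3 : ContMDiff 𝓘(ℝ, V) I ∞ (fun v => I.symm (ℓ.symm v)) := by
      refine fun v => (I.contMDiffOn_symm.contMDiffAt (by simp [I.range_eq_univ])).comp v
        ℓ.symm.contDiff.contMDiff.contMDiffAt
    have h5 : ContMDiffAt I I ∞ (chartAt H (h x)).symm (chartAt H (h x) (h x)) :=
      contMDiffOn_chart_symm.contMDiffAt
        ((chartAt H (h x)).open_target.mem_nhds (mem_chart_target H (h x)))
    have h6 := ContMDiffAt.comp (g := (chartAt H (h x)).symm) x (I' := I)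
      (by simpa [c] using h5) (h3.contMDiffAt.comp x h1)
    refine h6.congr_of_eventuallyEq ?_
    filter_upwards [(c (chartAt H (h x))).open_source.mem_nhds (mem_chart_source V x)] with y hy
    have hy' : h y ∈ (chartAt H (h x)).source := hy
    simp [c, hy']
  have hD' : ContMDiff I 𝓘(ℝ, V) ∞ h.symm := by
    intro y
    have hx : y = h (h.symm y) := (h.apply_symm_apply y).symm
    generalize h.symm y = x at hx
    subst hx
    have h1 : ContMDiffAt 𝓘(ℝ, V) 𝓘(ℝ, V) ∞ (c (chartAt H (h x))).symm
        (c (chartAt H (h x)) x) :=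
      contMDiffOn_chart_symm.contMDiffAt
        ((chartAt V x).open_target.mem_nhds (mem_chart_target V x))
    have h5 : ContMDiffAt I I ∞ (chartAt H (h x)) (h x) :=
      contMDiffOn_chart.contMDiffAt
        ((chartAt H (h x)).open_source.mem_nhds (mem_chart_source H (h x)))
    have h6 : ContMDiffAt I 𝓘(ℝ, V) ∞ (fun z => ℓ (I (chartAt H (h x) z))) (h x) :=
      ((ℓ.contDiff (n := ∞)).contMDiff.comp I.contMDiff).contMDiffAt.comp (h x) h5
    have h7 := ContMDiffAt.comp (g := (c (chartAt H (h x))).symm) (h x) h1 h6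
    refine h7.congr_of_eventuallyEq ?_
    filter_upwards [(chartAt H (h x)).open_source.mem_nhds (mem_chart_source H (h x))] with y hy
    simp [c, hy]
  exact ⟨cs, hman, ⟨h.toEquiv, hD, hD'⟩, fun _ => rfl⟩

end VectorChart

/-! ### Inverse function theorem with parameters -/

section ImplicitFunction

variable {E : Type*} [NormedAddCommGroup E] [NormedSpace ℝ E] [CompleteSpace E]
  {N : Type*} [TopologicalSpace N] [ChartedSpace E N] [IsManifold 𝓘(ℝ, E) ∞ N]
  {V W : Type*} [NormedAddCommGroup V] [NormedSpace ℝ V] [CompleteSpace V]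
  [NormedAddCommGroup W] [NormedSpace ℝ W]

/-- No continuity of `X` is assumed. The local inverse of `(n, v) ↦ (n, F (n, v))` is smooth and a
right inverse, and since `X` undoes `F` for every `v`, not only those near `v₀`, it must agree with
that local inverse. -/
theorem contMDiffAt_of_leftInverse_of_hasFDerivAt {F : N × V → W} {n₀ : N} {v₀ : V}
    (hF : ContMDiffAt (𝓘(ℝ, E).prod 𝓘(ℝ, V)) 𝓘(ℝ, W) ∞ F (n₀, v₀)) (A : V ≃L[ℝ] W)
    (hA : HasFDerivAt (fun v => F (n₀, v)) (A : V →L[ℝ] W) v₀) {X : N × W → V}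
    (hX : ∀ᶠ n in 𝓝 n₀, ∀ v, X (n, F (n, v)) = v) :
    ContMDiffAt (𝓘(ℝ, E).prod 𝓘(ℝ, W)) 𝓘(ℝ, V) ∞ X (n₀, F (n₀, v₀)) := by
  set φ := chartAt E n₀ with hφ
  have hn₀ : φ.symm (φ n₀) = n₀ := φ.left_inv (mem_chart_source E n₀)
  have hφs : ContMDiffAt 𝓘(ℝ, E) 𝓘(ℝ, E) ∞ φ.symm (φ n₀) :=
    contMDiffOn_chart_symm.contMDiffAt (φ.open_target.mem_nhds (mem_chart_target E n₀))
  have hφc : ContMDiffAt 𝓘(ℝ, E) 𝓘(ℝ, E) ∞ φ n₀ :=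
    contMDiffOn_chart.contMDiffAt (φ.open_source.mem_nhds (mem_chart_source E n₀))
  let F' : E × V → W := fun z => F (φ.symm z.1, z.2)
  have hF' : ContDiffAt ℝ ∞ F' (φ n₀, v₀) := by
    rw [← contMDiffAt_iff_contDiffAt]
    have h1 : ContMDiffAt 𝓘(ℝ, E × V) (𝓘(ℝ, E).prod 𝓘(ℝ, V)) ∞
        (fun z : E × V => (φ.symm z.1, z.2)) (φ n₀, v₀) :=
      (ContMDiffAt.comp (g := φ.symm) (φ n₀, v₀) hφs contDiffAt_fst.contMDiffAt).prodMk
        contDiffAt_snd.contMDiffAt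
    refine ContMDiffAt.comp (g := F) (φ n₀, v₀) ?_ h1
    simpa only [hn₀] using hF
  let Gf : E × V → E × W := fun z => (z.1, F' z)
  have hG : ContDiffAt ℝ ∞ Gf (φ n₀, v₀) := contDiffAt_fst.prodMk hF'
  have hd : HasFDerivAt F' (fderiv ℝ F' (φ n₀, v₀)) (φ n₀, v₀) :=
    (hF'.differentiableAt (by simp)).hasFDerivAt
  have hpart : (fderiv ℝ F' (φ n₀, v₀)).comp (ContinuousLinearMap.inr ℝ E V) = A := by
    have h1 : HasFDerivAt (fun v : V => (φ n₀, v)) (ContinuousLinearMap.inr ℝ E V) v₀ :=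
      hasFDerivAt_prodMk_right _ _
    have h2 := hd.comp v₀ h1
    have h3 : F' ∘ (fun v : V => (φ n₀, v)) = fun v => F (n₀, v) := by
      funext v; simp only [Function.comp, F', hn₀]
    rw [h3] at h2
    exact h2.unique hA
  -- The derivative of `(n, v) ↦ (n, F (n, v))` is block triangular with diagonal blocks the
  -- identity and `A`, hence invertible.
  let B : (E × V) ≃L[ℝ] (E × W) := ContinuousLinearEquiv.skewProd (.refl ℝ E) A
    ((fderiv ℝ F' (φ n₀, v₀)).comp (ContinuousLinearMap.inl ℝ E V))
  have hB : HasFDerivAt Gf (B : (E × V) →L[ℝ] (E × W)) (φ n₀, v₀) := by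
    have h1 := (hasFDerivAt_fst (𝕜 := ℝ) (p := (φ n₀, v₀))).prodMk hd
    refine h1.congr_fderiv ?_
    refine ContinuousLinearMap.ext fun z => Prod.ext rfl ?_
    have h2 : A z.2 = fderiv ℝ F' (φ n₀, v₀) (0, z.2) := (DFunLike.congr_fun hpart z.2).symm
    change fderiv ℝ F' (φ n₀, v₀) z = A z.2 + fderiv ℝ F' (φ n₀, v₀) (z.1, 0)
    rw [h2, ← map_add]
    simp
  have hinv := hG.to_localInverse hB (by simp)
  set g := hG.localInverse hB (by simp) with hg
  have hright : ∀ᶠ y in 𝓝 (Gf (φ n₀, v₀)), Gf (g y) = y :=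
    (hG.hasStrictFDerivAt' hB (by simp)).eventually_right_inverse
  have hG0 : Gf (φ n₀, v₀) = (φ n₀, F (n₀, v₀)) := by simp only [Gf, F', hn₀]
  rw [hG0] at hinv hright
  have hp : ContMDiffAt (𝓘(ℝ, E).prod 𝓘(ℝ, W)) 𝓘(ℝ, E × W) ∞
      (fun z : N × W => (φ z.1, z.2)) (n₀, F (n₀, v₀)) := by
    exact (ContMDiffAt.comp (g := φ) (n₀, F (n₀, v₀)) hφc contMDiffAt_fst).prodMk_space
      contMDiffAt_snd
  have hcomp : ContMDiffAt (𝓘(ℝ, E).prod 𝓘(ℝ, W)) 𝓘(ℝ, V) ∞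
      (fun z : N × W => (g (φ z.1, z.2)).2) (n₀, F (n₀, v₀)) := by
    have h1 : ContDiffAt ℝ ∞ (fun y => (g y).2) (φ n₀, F (n₀, v₀)) := contDiffAt_snd.comp _ hinv
    exact ContMDiffAt.comp (g := fun y => (g y).2) (n₀, F (n₀, v₀)) h1.contMDiffAt hp
  refine hcomp.congr_of_eventuallyEq ?_
  have e1 : ∀ᶠ z : N × W in 𝓝 (n₀, F (n₀, v₀)), Gf (g (φ z.1, z.2)) = (φ z.1, z.2) :=
    hp.continuousAt.eventually hright
  have e2 : ∀ᶠ z : N × W in 𝓝 (n₀, F (n₀, v₀)), z.1 ∈ φ.source :=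
    continuousAt_fst.eventually (φ.open_source.mem_nhds (mem_chart_source E n₀))
  have e3 : ∀ᶠ z : N × W in 𝓝 (n₀, F (n₀, v₀)), ∀ v, X (z.1, F (z.1, v)) = v :=
    continuousAt_fst.tendsto.eventually (p := fun n => ∀ v, X (n, F (n, v)) = v) hX
  filter_upwards [e1, e2, e3] with z h1 h2 h3
  have h4 : (g (φ z.1, z.2)).1 = φ z.1 := congrArg Prod.fst h1
  have h5 : F (z.1, (g (φ z.1, z.2)).2) = z.2 := by
    have := congrArg Prod.snd h1
    simpa only [Gf, F', h4, φ.left_inv h2] using this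
  have h6 := h3 (g (φ z.1, z.2)).2
  rwa [h5] at h6

end ImplicitFunction

/-! ### Derivative and fibre dimension of a submersion -/

section SubmersionDerivative

variable {E : Type*} [NormedAddCommGroup E] [NormedSpace ℝ E]
  {M : Type*} [TopologicalSpace M] [ChartedSpace E M] [IsManifold 𝓘(ℝ, E) ∞ M]
  {E' : Type*} [NormedAddCommGroup E'] [NormedSpace ℝ E']
  {M' : Type*} [TopologicalSpace M'] [ChartedSpace E' M'] [IsManifold 𝓘(ℝ, E') ∞ M']
  {F : Type*} [NormedAddCommGroup F] [NormedSpace ℝ F]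

/-- The derivative of a local section through `x` is a right inverse. -/
theorem mfderiv_surjective_of_isSubmersionAt {f : M → M'} {x : M}
    (hf : Manifold.IsSubmersionAtOfComplement F 𝓘(ℝ, E) 𝓘(ℝ, E') ∞ f x) :
    Function.Surjective (mfderiv 𝓘(ℝ, E) 𝓘(ℝ, E') f x) := by
  obtain ⟨σ, hσ, hx, h⟩ := IsSubmersionAtOfComplement.exists_section hf
  have h1 : HasMFDerivAt 𝓘(ℝ, E') 𝓘(ℝ, E) σ (f x) (mfderiv 𝓘(ℝ, E') 𝓘(ℝ, E) σ (f x)) :=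
    (hσ.mdifferentiableAt (by simp)).hasMFDerivAt
  have h2 : HasMFDerivAt 𝓘(ℝ, E) 𝓘(ℝ, E') f (σ (f x)) (mfderiv 𝓘(ℝ, E) 𝓘(ℝ, E') f (σ (f x))) := by
    rw [hx]
    exact (hf.contMDiffAt.mdifferentiableAt (by simp)).hasMFDerivAt
  have h3 := (h2.comp (f x) h1).congr_of_eventuallyEq (f₁ := id) (h.mono fun z hz => hz.symm)
  have h4 := hasMFDerivAt_unique h3 (hasMFDerivAt_id (f x))
  rw [hx] at h4
  intro w
  exact ⟨mfderiv 𝓘(ℝ, E') 𝓘(ℝ, E) σ (f x) w, DFunLike.congr_fun h4 w⟩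

theorem finrank_of_isSubmersionAt [FiniteDimensional ℝ E] {f : M → M'} {x : M}
    (hf : Manifold.IsSubmersionAtOfComplement F 𝓘(ℝ, E) 𝓘(ℝ, E') ∞ f x) :
    FiniteDimensional ℝ F ∧
      Module.finrank ℝ E = Module.finrank ℝ E' + Module.finrank ℝ F := by
  have h : FiniteDimensional ℝ (E' × F) := hf.equiv.toLinearEquiv.finiteDimensional
  have h1 : FiniteDimensional ℝ E' :=
    Module.Finite.of_surjective (LinearMap.fst ℝ E' F) LinearMap.fst_surjective
  have h2 : FiniteDimensional ℝ F :=
    Module.Finite.of_surjective (LinearMap.snd ℝ E' F) LinearMap.snd_surjective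
  exact ⟨h2, by rw [hf.equiv.toLinearEquiv.finrank_eq, Module.finrank_prod]⟩

end SubmersionDerivative

/-! ### The kernel of `Tπ` is spanned by the generators -/

section Orbit

variable {E : Type*} [NormedAddCommGroup E] [NormedSpace ℝ E] [FiniteDimensional ℝ E]
  {EG : Type*} [NormedAddCommGroup EG] [NormedSpace ℝ EG] [FiniteDimensional ℝ EG]
  {Q : Type*} [TopologicalSpace Q] [ChartedSpace E Q] [IsManifold 𝓘(ℝ, E) ∞ Q]
  {G : Type*} [Group G] [TopologicalSpace G] [ChartedSpace EG G] [LieGroup 𝓘(ℝ, EG) ∞ G]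
  [MulAction G Q] [ContMDiffSMul 𝓘(ℝ, EG) 𝓘(ℝ, E) ∞ G Q]
  {EB : Type*} [NormedAddCommGroup EB] [NormedSpace ℝ EB]
  [ChartedSpace EB (OrbitSpace G Q)] [IsManifold 𝓘(ℝ, EB) ∞ (OrbitSpace G Q)]
  {F : Type*} [NormedAddCommGroup F] [NormedSpace ℝ F]

/-- The orbit maps of a free proper action are topological embeddings. -/
theorem isInducing_smul_of_properSMul {G Q : Type*} [Group G] [TopologicalSpace G]
    [TopologicalSpace Q] [MulAction G Q] [ProperSMul G Q]
    (hfree : ∀ (g : G) (q : Q), g • q = q → g = 1) (q : Q) :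
    Topology.IsInducing (fun g : G => g • q) := by
  have hp := ProperSMul.isProperMap_smul_pair (G := G) (X := Q)
  have hinj : Function.Injective (fun gx : G × Q => (gx.1 • gx.2, gx.2)) := by
    rintro ⟨g, x⟩ ⟨g', x'⟩ h
    obtain ⟨h1, rfl⟩ := Prod.mk.inj h
    have h2 : (g'⁻¹ * g) • x = x := by rw [mul_smul, inv_smul_eq_iff]; exact h1
    rw [inv_mul_eq_one.1 (hfree _ _ h2)]
  -- Properness makes `(g, x) ↦ (g • x, x)` closed and freeness makes it injective, so it is a
  -- closed embedding; it is then restricted to `x = q`.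
  have he := (Topology.IsClosedEmbedding.of_continuous_injective_isClosedMap
    hp.continuous hinj hp.isClosedMap).isInducing
  have h1 : Topology.IsInducing (fun g : G => (g, q)) := (isEmbedding_prodMkLeft q).isInducing
  have h2 : Topology.IsInducing ((fun x : Q => (x, q)) ∘ fun g : G => g • q) := he.comp h1
  refine Topology.IsInducing.of_comp ?_ (by fun_prop) h2
  exact continuous_fst.comp (he.comp h1).continuous

/-- In submersion charts the fibre of `π` through `q` is a piece of `F`, and it consists of points
`g • q`. Near `q` the element `g` must be near `1`, so this piece lies in the image of a small ball
of `𝔤` under a `C¹` map. If `dim 𝔤 < dim F`, such an image has dense complement, which is absurd. -/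
theorem finrank_complement_le_of_free [ProperSMul G Q]
    (hfree : ∀ (g : G) (q : Q), g • q = q → g = 1) {q : Q}
    (hπ : Manifold.IsSubmersionAtOfComplement F 𝓘(ℝ, E) 𝓘(ℝ, EB) ∞ (toOrbit G : Q → _) q) :
    Module.finrank ℝ F ≤ Module.finrank ℝ EG := by
  have hF := (finrank_of_isSubmersionAt hπ).1
  by_contra! hlt
  obtain ⟨φ, ψ, e, hφ, hψ, hq, hm, h⟩ := IsSubmersionAtOfComplement.exists_vectorChart hπ
  set c := chartAt EG (1 : G)
  have hc1 : c.symm (c 1) = 1 := c.left_inv (mem_chart_source EG 1)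
  let f : EG → F := fun z => (e (φ (c.symm z • q))).2
  have hf : ContDiffAt ℝ ∞ f (c 1) := by
    rw [← contMDiffAt_iff_contDiffAt]
    have h1 : ContMDiffAt 𝓘(ℝ, EG) 𝓘(ℝ, EG) ∞ c.symm (c 1) :=
      contMDiffOn_chart_symm.contMDiffAt (c.open_target.mem_nhds (mem_chart_target EG 1))
    have h2 : ContMDiffAt 𝓘(ℝ, EG) 𝓘(ℝ, E) ∞ (fun z => c.symm z • q) (c 1) :=
      (contMDiff_smul_const EG q).contMDiffAt.comp (c 1) h1
    have h3 : ContMDiffAt 𝓘(ℝ, E) 𝓘(ℝ, E) ∞ φ (c.symm (c 1) • q) := by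
      rw [hc1, one_smul]
      exact hφ.contMDiffOn.contMDiffAt (φ.open_source.mem_nhds hq)
    have h4 : ContDiff ℝ ∞ (fun x => (e x).2) := contDiff_snd.comp e.contDiff
    exact h4.contMDiff.contMDiffAt.comp (c 1) (ContMDiffAt.comp (g := φ) (c 1) h3 h2)
  obtain ⟨u, hu, hfu⟩ := hf.contDiffOn (m := 1) (by simp) (by simp)
  obtain ⟨r, hr, hball⟩ := Metric.mem_nhds_iff.1
    (inter_mem hu (c.open_target.mem_nhds (mem_chart_target EG 1)))
  have hdense := (hfu.mono (fun z hz => (hball hz).1)).dense_compl_image_of_dimH_lt_finrank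
    (convex_ball (c 1) r) Subset.rfl
    (lt_of_le_of_lt ((dimH_mono (subset_univ _)).trans (Real.dimH_univ_eq_finrank EG).le)
      (Nat.cast_lt.2 hlt))
  have hnhds : ∀ᶠ g : G in 𝓝 1, c g ∈ Metric.ball (c 1) r ∧ g ∈ c.source :=
    ((c.continuousAt (mem_chart_source EG 1)).eventually (Metric.ball_mem_nhds _ hr)).and
      (c.open_source.mem_nhds (mem_chart_source EG 1))
  -- Here properness enters: if `g • q` is close to `q`, then `g` is close to `1`.
  rw [(isInducing_smul_of_properSMul hfree q).nhds_eq_comap, one_smul, eventually_comap] at hnhds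
  have hcont : ContinuousAt (fun y : F => e.symm (ψ (toOrbit G q), y)) (e (φ q)).2 := by fun_prop
  have hy0 : e.symm (ψ (toOrbit G q), (e (φ q)).2) = φ q := by
    rw [h q hq, Prod.mk.eta, e.symm_apply_apply]
  have hev1 : ∀ᶠ y in 𝓝 (e (φ q)).2, e.symm (ψ (toOrbit G q), y) ∈ φ.target :=
    hcont.eventually (φ.open_target.mem_nhds (by simp only [hy0, φ.map_source hq]))
  have hev2 : ∀ᶠ y in 𝓝 (e (φ q)).2, ∀ g : G,
      g • q = φ.symm (e.symm (ψ (toOrbit G q), y)) → c g ∈ Metric.ball (c 1) r ∧ g ∈ c.source := by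
    have hcont' : ContinuousAt (fun y : F => φ.symm (e.symm (ψ (toOrbit G q), y))) (e (φ q)).2 := by
      refine ContinuousAt.comp (g := φ.symm) ?_ hcont
      rw [hy0]
      exact φ.continuousAt_symm (φ.map_source hq)
    refine hcont'.tendsto.eventually (p := fun b => ∀ g : G,
      g • q = b → c g ∈ Metric.ball (c 1) r ∧ g ∈ c.source) ?_
    rw [hy0, φ.left_inv hq]
    exact hnhds
  -- A fibre coordinate `y` outside the image, yet so close to that of `q` that the point it
  -- describes is `g • q` with `g` in the ball.
  obtain ⟨y, hyc, hy1, hy2⟩ := (hdense.inter_nhds_nonempty (hev1.and hev2))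
  refine hyc ?_
  have hp := φ.map_target hy1
  have horb : toOrbit G (φ.symm (e.symm (ψ (toOrbit G q), y))) = toOrbit G q := by
    refine ψ.injOn (hm hp) (hm hq) ?_
    rw [h _ hp, φ.right_inv hy1, e.apply_symm_apply]
  obtain ⟨g, hg⟩ := MulAction.orbitRel_apply.1 (Quotient.exact horb)
  obtain ⟨hg1, hg2⟩ := hy2 g hg
  refine ⟨c g, hg1, ?_⟩
  have hg' : g • q = _ := hg
  simp only [f, c.left_inv hg2, hg', φ.right_inv hy1, e.apply_symm_apply]

theorem mfderiv_toOrbit_generator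
    (hπ : ContMDiff 𝓘(ℝ, E) 𝓘(ℝ, EB) ∞ (toOrbit G : Q → OrbitSpace G Q)) (q : Q) (ξ : EG) :
    mfderiv 𝓘(ℝ, E) 𝓘(ℝ, EB) (toOrbit G : Q → OrbitSpace G Q) q (generator E EG G q ξ) = 0 := by
  have h1 : HasMFDerivAt 𝓘(ℝ, EG) 𝓘(ℝ, E) (fun g : G => g • q) 1
      (mfderiv 𝓘(ℝ, EG) 𝓘(ℝ, E) (fun g : G => g • q) 1) :=
    ((contMDiff_smul_const EG q).mdifferentiable (by simp) 1).hasMFDerivAt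
  have h2 := (hπ.mdifferentiable (by simp) ((1 : G) • q)).hasMFDerivAt
  have h3 := h2.comp (1 : G) h1
  have h4 : (toOrbit G : Q → OrbitSpace G Q) ∘ (fun g : G => g • q) = fun _ => toOrbit G q := by
    funext g
    exact Quotient.sound ⟨g, rfl⟩
  rw [h4] at h3
  have h5 := hasMFDerivAt_unique h3 (hasMFDerivAt_const (toOrbit G q) (1 : G))
  have h6 := DFunLike.congr_fun h5 ξ
  -- The chain rule lives at `1 • q`, equal to `q` only propositionally; this moves the vanishing to
  -- `q`.
  have h7 : ∀ (q' : Q), q' = q → ∀ w : E,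
      (mfderiv 𝓘(ℝ, E) 𝓘(ℝ, EB) (toOrbit G : Q → OrbitSpace G Q) q' : E → EB) w = 0 →
      (mfderiv 𝓘(ℝ, E) 𝓘(ℝ, EB) (toOrbit G : Q → OrbitSpace G Q) q : E → EB) w = 0 := by
    rintro q' rfl w hw
    exact hw
  exact h7 _ (one_smul G q) _ h6

theorem exists_generator_eq [ProperSMul G Q]
    (hfree : ∀ (g : G) (q : Q), g • q = q → g = 1)
    (hπ : Manifold.IsSubmersionOfComplement F 𝓘(ℝ, E) 𝓘(ℝ, EB) ∞ (toOrbit G : Q → OrbitSpace G Q))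
    {q : Q} (hinj : Function.Injective (generator E EG G q)) {w : TangentSpace 𝓘(ℝ, E) q}
    (hw : mfderiv 𝓘(ℝ, E) 𝓘(ℝ, EB) (toOrbit G : Q → OrbitSpace G Q) q w = 0) :
    ∃ ξ, generator E EG G q ξ = w := by
  obtain ⟨hF, hdim⟩ := finrank_of_isSubmersionAt (hπ q)
  have hle := finrank_complement_le_of_free (EG := EG) hfree (hπ q)
  let D' : E →L[ℝ] EB := mfderiv 𝓘(ℝ, E) 𝓘(ℝ, EB) (toOrbit G : Q → OrbitSpace G Q) q
  let g' : EG →L[ℝ] E := generator E EG G q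
  let D : E →ₗ[ℝ] EB := D'
  let g : EG →ₗ[ℝ] E := g'
  have hD : Function.Surjective D := mfderiv_surjective_of_isSubmersionAt (hπ q)
  have h1 : LinearMap.range g ≤ LinearMap.ker D := by
    rintro _ ⟨ξ, rfl⟩
    exact mfderiv_toOrbit_generator hπ.contMDiff q ξ
  have h2 := LinearMap.finrank_range_add_finrank_ker D
  rw [LinearMap.range_eq_top.2 hD, finrank_top] at h2
  have h3 : Module.finrank ℝ (LinearMap.range g) = Module.finrank ℝ EG :=
    LinearMap.finrank_range_of_inj hinj
  -- By rank–nullity `dim ker D = dim F ≤ dim 𝔤 = dim range g`, so the inclusion is an equality.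
  have h4 := Submodule.eq_of_le_of_finrank_le h1 (by omega)
  have h5 : (w : E) ∈ LinearMap.ker D := hw
  rw [← h4] at h5
  exact h5

end Orbit

/-! ### The splitting of `T¹ₖQ`: bijectivity and fibre derivative -/

section LegendreSplitting

variable {k : ℕ}
  {E : Type*} [NormedAddCommGroup E] [NormedSpace ℝ E] [FiniteDimensional ℝ E]
  {EG : Type*} [NormedAddCommGroup EG] [NormedSpace ℝ EG] [FiniteDimensional ℝ EG]
  {Q : Type*} [TopologicalSpace Q] [ChartedSpace E Q] [IsManifold 𝓘(ℝ, E) ∞ Q]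
  {G : Type*} [Group G] [TopologicalSpace G] [ChartedSpace EG G] [LieGroup 𝓘(ℝ, EG) ∞ G]
  [MulAction G Q] [ContMDiffSMul 𝓘(ℝ, EG) 𝓘(ℝ, E) ∞ G Q]
  {EB : Type*} [NormedAddCommGroup EB] [NormedSpace ℝ EB] [FiniteDimensional ℝ EB]
  [ChartedSpace EB (OrbitSpace G Q)] [IsManifold 𝓘(ℝ, EB) ∞ (OrbitSpace G Q)]
  {F : Type*} [NormedAddCommGroup F] [NormedSpace ℝ F]

variable (Q G) in
/-- The projection `Q → Q/G` as a continuous map. -/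
def orbitProj : C(Q, OrbitSpace G Q) := ⟨toOrbit G, continuous_quot_mk⟩

variable (k Q G EB) in
/-- The pullback `Q ×_{Q/G} T¹ₖ(Q/G)` of the velocity bundle of `Q/G` along `Q → Q/G`. -/
abbrev PulledVelocity : Type _ :=
  Bundle.TotalSpace (Fin k → EB)
    (orbitProj Q G *ᵖ (VelocitySpace EB k : OrbitSpace G Q → Type _))

/-- The derivative of `Q → Q/G` at `q`, as a map of model spaces. -/
def orbitDeriv (G : Type*) [Group G] {E : Type*} [NormedAddCommGroup E] [NormedSpace ℝ E]
    (EB : Type*) [NormedAddCommGroup EB] [NormedSpace ℝ EB]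
    {Q : Type*} [TopologicalSpace Q] [ChartedSpace E Q] [MulAction G Q]
    [ChartedSpace EB (OrbitSpace G Q)] (q : Q) : E →L[ℝ] EB :=
  mfderiv 𝓘(ℝ, E) 𝓘(ℝ, EB) (toOrbit G : Q → OrbitSpace G Q) q

variable (G EB) in
/-- The map `v ↦ (q, Tπ(v₁), …, Tπ(vₖ))`. -/
def toPulled (v : VelocityBundle E k Q) : PulledVelocity k Q G EB :=
  ⟨v.proj, kfold k (E := E) (orbitDeriv G EB v.proj) v.snd⟩

theorem contMDiff_toPulled
    (hπ : ContMDiff 𝓘(ℝ, E) 𝓘(ℝ, EB) ∞ (toOrbit G : Q → OrbitSpace G Q)) :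
    ContMDiff (𝓘(ℝ, E).prod 𝓘(ℝ, Fin k → E)) (𝓘(ℝ, E).prod 𝓘(ℝ, Fin k → EB)) ∞
      (toPulled G EB : VelocityBundle E k Q → PulledVelocity k Q G EB) := by
  intro v
  rw [contMDiffAt_pullback_iff (hπ.contMDiffAt : ContMDiffAt _ _ _ (orbitProj Q G) _)]
  exact ⟨contMDiff_velocity_proj v, contMDiff_velocityMap hπ v⟩

/-- `G`-regularity restated with translation as addition of a linear image in the model fibre. -/
theorem momentum_translate {L : VelocityBundle E k Q → ℝ} (hreg : IsGRegular EG G L)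
    (q : Q) (u : Fin k → E) :
    ∃ Ψ : (Fin k → EG) ≃ₘ^∞⟮𝓘(ℝ, Fin k → EG), 𝓘(ℝ, Fin k → EG →L[ℝ] ℝ)⟯ (Fin k → EG →L[ℝ] ℝ),
      ∀ ξ : Fin k → EG, momentum EG G L (⟨q, u + kfold k (E' := E) (generator E EG G q) ξ⟩ :
        VelocityBundle E k Q) = Ψ ξ := by
  obtain ⟨Ψ, hΨ⟩ := hreg ⟨q, u⟩
  exact ⟨Ψ, fun ξ => (hΨ ξ).symm⟩

/-- If `ξ` and `η` have the same generator at `q`, translating by the constant families `ξ` and `η`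
gives the same momentum. The index `a` is there to guarantee `k ≥ 1`. -/
theorem generator_injective {L : VelocityBundle E k Q → ℝ} (hreg : IsGRegular EG G L)
    (a : Fin k) (q : Q) : Function.Injective (generator E EG G q) := by
  obtain ⟨Ψ, hΨ⟩ := momentum_translate hreg q 0
  intro ξ η h
  have h1 : Ψ (fun _ => ξ) = Ψ (fun _ => η) := by 
    rw [← hΨ, ← hΨ]
    congr 3
    exact funext fun _ => h
  exact congrFun (Ψ.injective h1) a

theorem exists_kfold_generator [ProperSMul G Q]
    (hfree : ∀ (g : G) (q : Q), g • q = q → g = 1)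
    (hπ : Manifold.IsSubmersionOfComplement F 𝓘(ℝ, E) 𝓘(ℝ, EB) ∞ (toOrbit G : Q → OrbitSpace G Q))
    {L : VelocityBundle E k Q → ℝ} (hreg : IsGRegular EG G L) (q : Q) (u : Fin k → E)
    (hu : kfold k (orbitDeriv G EB q) u = 0) :
    ∃ ξ : Fin k → EG, kfold k (E' := E) (generator E EG G q) ξ = u := by
  -- Each component supplies the index needed for injectivity, so `k = 0` is vacuous.
  have h : ∀ a, ∃ ξ : EG, (generator E EG G q : EG →L[ℝ] E) ξ = u a := fun a =>
    exists_generator_eq hfree hπ (generator_injective hreg a q) (congrFun hu a)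
  choose ξ hξ using h
  exact ⟨ξ, funext hξ⟩

/-- On vertical vectors the first component vanishes and the second is the derivative at `0` of the
regularity diffeomorphism, hence invertible. The first component is surjective with exactly the
vertical vectors as kernel, so the pair is bijective. -/
theorem exists_fiberwise_derivative_equiv [ProperSMul G Q]
    (hfree : ∀ (g : G) (q : Q), g • q = q → g = 1)
    (hπ : Manifold.IsSubmersionOfComplement F 𝓘(ℝ, E) 𝓘(ℝ, EB) ∞ (toOrbit G : Q → OrbitSpace G Q))
    {L : VelocityBundle E k Q → ℝ}
    (hL : ContMDiff (𝓘(ℝ, E).prod 𝓘(ℝ, Fin k → E)) 𝓘(ℝ, ℝ) ∞ L)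
    (hreg : IsGRegular EG G L) (v : VelocityBundle E k Q) :
    ∃ A : (Fin k → E) ≃L[ℝ] ((Fin k → EB) × (Fin k → EG →L[ℝ] ℝ)),
      HasFDerivAt (fun u : Fin k → E =>
        (kfold k (orbitDeriv G EB v.proj) u, momentum EG G L (⟨v.proj, u⟩ : VelocityBundle E k Q)))
        (A : (Fin k → E) →L[ℝ] ((Fin k → EB) × (Fin k → EG →L[ℝ] ℝ))) v.snd := by
  let J : (Fin k → E) → (Fin k → EG →L[ℝ] ℝ) :=
    fun u => momentum EG G L (⟨v.proj, u⟩ : VelocityBundle E k Q)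
  have hJ : HasFDerivAt J (fderiv ℝ J v.snd) v.snd := by
    have h : ContDiff ℝ ∞ J :=
      ((contMDiff_momentum (EG := EG) (G := G) hL).comp (contMDiff_fiber v.proj)).contDiff
    exact (h.differentiable (by simp)).differentiableAt.hasFDerivAt
  let D : E →L[ℝ] EB := orbitDeriv G EB v.proj
  have hDsurj : Function.Surjective D := mfderiv_surjective_of_isSubmersionAt
    (E := E) (E' := EB) (hπ v.proj)
  let g : EG →L[ℝ] E := generator E EG G v.proj
  obtain ⟨Ψ, hΨ⟩ := momentum_translate hreg v.proj v.snd
  have hgD : ∀ ξ : Fin k → EG, kfold k D (kfold k g ξ) = 0 := fun ξ =>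
    funext fun a => mfderiv_toOrbit_generator hπ.contMDiff v.proj (ξ a)
  have hΨ' : ∀ ξ : Fin k → EG, fderiv ℝ J v.snd (kfold k g ξ) =
      Ψ.mfderivToContinuousLinearEquiv (by simp) 0 ξ := by
    intro ξ
    have h1 := hasFDerivAt_comp_add_kfold hJ g
    have h2 : (fun ξ : Fin k → EG => J fun a => (show Fin k → E from v.snd) a + g (ξ a)) = Ψ :=
      funext hΨ
    rw [h2] at h1
    have h3 : mfderiv 𝓘(ℝ, Fin k → EG) 𝓘(ℝ, Fin k → EG →L[ℝ] ℝ) Ψ 0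
        = (fderiv ℝ J v.snd).comp (kfold k g) := by
      rw [mfderiv_eq_fderiv]; exact h1.fderiv
    exact (DFunLike.congr_fun h3 ξ).symm
  let A₀ : (Fin k → E) →L[ℝ] ((Fin k → EB) × (Fin k → EG →L[ℝ] ℝ)) :=
    (kfold k D).prod (fderiv ℝ J v.snd)
  have hbij : Function.Bijective A₀ := by
    constructor
    · refine (injective_iff_map_eq_zero A₀).2 fun u hu => ?_
      obtain ⟨ξ, rfl⟩ := exists_kfold_generator hfree hπ hreg v.proj u (congrArg Prod.fst hu)
      have h1 : fderiv ℝ J v.snd (kfold k g ξ) = 0 := congrArg Prod.snd hu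
      rw [hΨ'] at h1
      have h2 : ξ = 0 := (Ψ.mfderivToContinuousLinearEquiv (by simp) 0).map_eq_zero_iff.1 h1
      rw [h2, map_zero]
    · rintro ⟨b, ν⟩
      choose u hu using fun a => hDsurj (b a)
      -- The vertical correction that repairs the second component of the lift `u` without changing
      -- its projection.
      let ξ : Fin k → EG :=
        (Ψ.mfderivToContinuousLinearEquiv (by simp) 0).symm (ν - fderiv ℝ J v.snd u)
      refine ⟨u + kfold k g ξ, Prod.ext ?_ ?_⟩
      · change kfold k D (u + kfold k g ξ) = b
        rw [map_add, hgD, add_zero]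
        exact funext hu
      · change fderiv ℝ J v.snd (u + kfold k g ξ) = ν
        rw [map_add, hΨ']
        have : Ψ.mfderivToContinuousLinearEquiv (by simp) 0 ξ = ν - fderiv ℝ J v.snd u :=
          (Ψ.mfderivToContinuousLinearEquiv (by simp) 0).apply_symm_apply _
        rw [this, add_sub_cancel]
  refine ⟨(LinearEquiv.ofBijective (A₀ : _ →ₗ[ℝ] _) hbij).toContinuousLinearEquiv, ?_⟩
  exact ((kfold k D).hasFDerivAt.prodMk hJ)

variable (EB G) in
/-- The splitting `v ↦ ((q, Tπ(v₁), …, Tπ(vₖ)), J_L(v))` of `T¹ₖQ`. -/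
def splitting (L : VelocityBundle E k Q → ℝ) (v : VelocityBundle E k Q) :
    PulledVelocity k Q G EB × (Fin k → EG →L[ℝ] ℝ) :=
  (toPulled G EB v, momentum EG G L v)

/-- Velocities at `q` with equal projections differ by generators, and on such a family `J_L` is a
bijection: injectivity of `Ψ` separates them, and surjectivity corrects an arbitrary lift to any
momentum. -/
theorem splitting_bijective [ProperSMul G Q]
    (hfree : ∀ (g : G) (q : Q), g • q = q → g = 1)
    (hπ : Manifold.IsSubmersionOfComplement F 𝓘(ℝ, E) 𝓘(ℝ, EB) ∞ (toOrbit G : Q → OrbitSpace G Q))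
    {L : VelocityBundle E k Q → ℝ} (hreg : IsGRegular EG G L) :
    Function.Bijective (splitting G EB (EG := EG) L) := by
  constructor
  · rintro ⟨q, (u : Fin k → E)⟩ ⟨q', (u' : Fin k → E)⟩ h
    have h1 : toPulled G EB ⟨q, u⟩ = toPulled G EB ⟨q', u'⟩ := congrArg Prod.fst h
    have h2 : momentum EG G L ⟨q, u⟩ = momentum EG G L ⟨q', u'⟩ := congrArg Prod.snd h
    obtain rfl : q = q' := congrArg Bundle.TotalSpace.proj h1
    have h3 : kfold k (E := E) (orbitDeriv G EB q) u = kfold k (E := E) (orbitDeriv G EB q) u' :=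
      Bundle.TotalSpace.mk_inj.1 h1
    obtain ⟨ξ, hξ⟩ := exists_kfold_generator hfree hπ hreg q (u' - u)
      (by rw [map_sub, h3, sub_self])
    obtain ⟨Ψ, hΨ⟩ := momentum_translate hreg q u
    have h4 : Ψ ξ = Ψ 0 := by
      rw [← hΨ, ← hΨ]
      have e1 : u + kfold k (E' := E) (generator E EG G q) ξ = u' := by
        rw [hξ, add_sub_cancel]
      have e2 : u + kfold k (E' := E) (generator E EG G q) 0 = u := by rw [map_zero, add_zero]
      exact (congrArg (fun w : Fin k → E => momentum EG G L ⟨q, w⟩) e1).trans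
        (h2.symm.trans (congrArg (fun w : Fin k → E => momentum EG G L ⟨q, w⟩) e2).symm)
    rw [Ψ.injective h4, map_zero] at hξ
    exact congrArg _ (sub_eq_zero.1 hξ.symm).symm
  · rintro ⟨⟨q, w⟩, ν⟩
    choose u hu using fun a => mfderiv_surjective_of_isSubmersionAt (hπ q) (w a)
    obtain ⟨Ψ, hΨ⟩ := momentum_translate hreg q u
    refine ⟨⟨q, fun a => u a + generator E EG G q (Ψ.symm ν a)⟩, Prod.ext ?_ ?_⟩
    · refine congrArg (Bundle.TotalSpace.mk q) (funext fun a => ?_)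
      refine (map_add (mfderiv 𝓘(ℝ, E) 𝓘(ℝ, EB) (toOrbit G : Q → OrbitSpace G Q) q) _ _).trans ?_
      rw [mfderiv_toOrbit_generator hπ.contMDiff, add_zero]
      exact hu a
    · exact (hΨ _).trans (Ψ.apply_symm_apply ν)

end LegendreSplitting

/-! ### Pullback bundles as manifolds -/

section PullbackManifold

variable {k : ℕ}
  {E : Type*} [NormedAddCommGroup E] [NormedSpace ℝ E]
  {M : Type*} [TopologicalSpace M] [ChartedSpace E M] [IsManifold 𝓘(ℝ, E) ∞ M]
  {E' : Type*} [NormedAddCommGroup E'] [NormedSpace ℝ E']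
  {M' : Type*} [TopologicalSpace M'] [ChartedSpace E' M'] [IsManifold 𝓘(ℝ, E') ∞ M']

theorem contMDiffVectorBundle_pullback (p : C(M', M)) (hp : ContMDiff 𝓘(ℝ, E') 𝓘(ℝ, E) ∞ p) :
    ContMDiffVectorBundle ∞ (Fin k → E) (p *ᵖ (VelocitySpace E k : M → Type _)) 𝓘(ℝ, E') :=
  ContMDiffVectorBundle.pullback (Fin k → E) (VelocitySpace E k : M → Type _) 𝓘(ℝ, E')
    (⟨p, hp⟩ : ContMDiffMap 𝓘(ℝ, E') 𝓘(ℝ, E) M' M ∞)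

theorem isManifold_pullback (p : C(M', M)) (hp : ContMDiff 𝓘(ℝ, E') 𝓘(ℝ, E) ∞ p) :
    IsManifold (𝓘(ℝ, E').prod 𝓘(ℝ, Fin k → E)) ∞
      (Bundle.TotalSpace (Fin k → E) (p *ᵖ (VelocitySpace E k : M → Type _))) :=
  haveI := contMDiffVectorBundle_pullback (k := k) p hp
  Bundle.TotalSpace.isManifold _ _

theorem velocity_trivializationAt_self (q : M) (v : Fin k → E) :
    (trivializationAt (Fin k → E) (VelocitySpace E k : M → Type _) q
      (⟨q, v⟩ : VelocityBundle E k M)).2 = v := by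
  funext a
  rw [velocity_trivializationAt_apply]
  exact tangentCoordChange_self (I := 𝓘(ℝ, E)) (by simp)

theorem velocity_trivializationAt_symm_self (q : M) (v : Fin k → E) :
    (trivializationAt (Fin k → E) (VelocitySpace E k : M → Type _) q).symm q v = v := by
  have h := (trivializationAt (Fin k → E) (VelocitySpace E k : M → Type _) q).symm_apply_apply_mk
    (FiberBundle.mem_baseSet_trivializationAt' q) (v : VelocitySpace E k q)
  rwa [velocity_trivializationAt_self] at h

end PullbackManifold

/-! ### The splitting is a diffeomorphism -/

section LegendreSplitting

variable {k : ℕ}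
  {E : Type*} [NormedAddCommGroup E] [NormedSpace ℝ E] [FiniteDimensional ℝ E]
  {EG : Type*} [NormedAddCommGroup EG] [NormedSpace ℝ EG] [FiniteDimensional ℝ EG]
  {Q : Type*} [TopologicalSpace Q] [ChartedSpace E Q] [IsManifold 𝓘(ℝ, E) ∞ Q]
  {G : Type*} [Group G] [TopologicalSpace G] [ChartedSpace EG G] [LieGroup 𝓘(ℝ, EG) ∞ G]
  [MulAction G Q] [ContMDiffSMul 𝓘(ℝ, EG) 𝓘(ℝ, E) ∞ G Q]
  {EB : Type*} [NormedAddCommGroup EB] [NormedSpace ℝ EB] [FiniteDimensional ℝ EB]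
  [ChartedSpace EB (OrbitSpace G Q)] [IsManifold 𝓘(ℝ, EB) ∞ (OrbitSpace G Q)]
  {F : Type*} [NormedAddCommGroup F] [NormedSpace ℝ F]

theorem contMDiff_splitting
    (hπ : ContMDiff 𝓘(ℝ, E) 𝓘(ℝ, EB) ∞ (toOrbit G : Q → OrbitSpace G Q))
    {L : VelocityBundle E k Q → ℝ}
    (hL : ContMDiff (𝓘(ℝ, E).prod 𝓘(ℝ, Fin k → E)) 𝓘(ℝ, ℝ) ∞ L) :
    ContMDiff (𝓘(ℝ, E).prod 𝓘(ℝ, Fin k → E))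
      ((𝓘(ℝ, E).prod 𝓘(ℝ, Fin k → EB)).prod 𝓘(ℝ, Fin k → EG →L[ℝ] ℝ)) ∞
      (splitting G EB (EG := EG) L) :=
  (contMDiff_toPulled hπ).prodMk (contMDiff_momentum hL)

/-- In fibre coordinates the splitting is a family of maps of fibres parametrized by `q`, so its
inverse falls under the inverse function theorem with parameters. -/
theorem contMDiffAt_splitting_inverse [ProperSMul G Q]
    (hfree : ∀ (g : G) (q : Q), g • q = q → g = 1)
    (hπ : Manifold.IsSubmersionOfComplement F 𝓘(ℝ, E) 𝓘(ℝ, EB) ∞ (toOrbit G : Q → OrbitSpace G Q))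
    {L : VelocityBundle E k Q → ℝ}
    (hL : ContMDiff (𝓘(ℝ, E).prod 𝓘(ℝ, Fin k → E)) 𝓘(ℝ, ℝ) ∞ L) (hreg : IsGRegular EG G L)
    {Θ : PulledVelocity k Q G EB × (Fin k → EG →L[ℝ] ℝ) → VelocityBundle E k Q}
    (hΘ : ∀ v, Θ (splitting G EB L v) = v) (v₀ : VelocityBundle E k Q) :
    ContMDiffAt ((𝓘(ℝ, E).prod 𝓘(ℝ, Fin k → EB)).prod 𝓘(ℝ, Fin k → EG →L[ℝ] ℝ))
      (𝓘(ℝ, E).prod 𝓘(ℝ, Fin k → E)) ∞ Θ (splitting G EB L v₀) := by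
  have hπs := hπ.contMDiff
  set q₀ := v₀.proj with hq₀
  let e := trivializationAt (Fin k → E) (VelocitySpace E k : Q → Type _) q₀
  let e' := trivializationAt (Fin k → EB) (VelocitySpace EB k : OrbitSpace G Q → Type _)
    (toOrbit G q₀)
  have hbase : ∀ᶠ q in 𝓝 q₀, q ∈ e.baseSet ∧ toOrbit G q ∈ e'.baseSet :=
    Filter.Eventually.and
      (e.open_baseSet.mem_nhds (FiberBundle.mem_baseSet_trivializationAt' q₀))
      (hπs.continuous.continuousAt.eventually
        (e'.open_baseSet.mem_nhds (FiberBundle.mem_baseSet_trivializationAt' (toOrbit G q₀))))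
  let z : Q × (Fin k → E) → VelocityBundle E k Q := fun y => ⟨y.1, e.symm y.1 y.2⟩
  -- `Fl` is the splitting and `X` its inverse, both read in the trivializations at `q₀` and at its
  -- image in `Q/G`.
  let Fl : Q × (Fin k → E) → (Fin k → EB) × (Fin k → EG →L[ℝ] ℝ) := fun y =>
    ((e' (velocityMap (toOrbit G) (z y) : VelocityBundle EB k (OrbitSpace G Q))).2,
      momentum EG G L (z y))
  let X : Q × ((Fin k → EB) × (Fin k → EG →L[ℝ] ℝ)) → (Fin k → E) := fun y =>
    (e (Θ (⟨y.1, e'.symm (toOrbit G y.1) y.2.1⟩, y.2.2))).2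
  have hz : ContMDiffAt (𝓘(ℝ, E).prod 𝓘(ℝ, Fin k → E)) (𝓘(ℝ, E).prod 𝓘(ℝ, Fin k → E)) ∞ z
      (q₀, v₀.snd) := by
    have h1 : (q₀, v₀.snd) ∈ e.target := e.mem_target.2 (FiberBundle.mem_baseSet_trivializationAt' q₀)
    have h2 := (e.contMDiffOn_symm (IB := 𝓘(ℝ, E)) (n := ∞)).contMDiffAt (e.open_target.mem_nhds h1)
    refine h2.congr_of_eventuallyEq ?_
    filter_upwards [e.open_target.mem_nhds h1] with y hy
    exact e.mk_symm (e.mem_target.1 hy) y.2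
  have hz₀ : ∀ u : Fin k → E, z (q₀, u) = ⟨q₀, u⟩ := fun u =>
    congrArg (Bundle.TotalSpace.mk q₀) (velocity_trivializationAt_symm_self q₀ u)
  have hFl : ContMDiffAt (𝓘(ℝ, E).prod 𝓘(ℝ, Fin k → E))
      𝓘(ℝ, (Fin k → EB) × (Fin k → EG →L[ℝ] ℝ)) ∞ Fl (q₀, v₀.snd) := by
    refine ContMDiffAt.prodMk_space ?_ ((contMDiff_momentum hL).contMDiffAt.comp _ hz)
    have h1 := (contMDiff_velocityMap (k := k) hπs).contMDiffAt.comp _ hz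
    have h2 := (Bundle.contMDiffAt_totalSpace.1 h1).2
    have h3 : (z (q₀, v₀.snd)).proj = q₀ := rfl
    exact h2
  obtain ⟨A, hA⟩ := exists_fiberwise_derivative_equiv hfree hπ hL hreg v₀
  -- Both trivializations are the identity on the central fibre, so the derivative of `Fl` there is
  -- the `A` computed above.
  have hFl₀ : ∀ u : Fin k → E, Fl (q₀, u) =
      (kfold k (orbitDeriv G EB q₀) u, momentum EG G L (⟨q₀, u⟩ : VelocityBundle E k Q)) := by
    intro u
    refine Prod.ext ?_ ?_
    · change (e' (velocityMap (toOrbit G) (z (q₀, u)))).2 = _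
      rw [hz₀]
      exact velocity_trivializationAt_self _ _
    · change momentum EG G L (z (q₀, u)) = _
      rw [hz₀]
  have hX : ∀ᶠ q in 𝓝 q₀, ∀ u, X (q, Fl (q, u)) = u := by
    filter_upwards [hbase] with q hq u
    have h1 : e'.symm (toOrbit G q) (e' (velocityMap (toOrbit G) (z (q, u)))).2
        = (velocityMap (toOrbit G) (z (q, u)) : VelocityBundle EB k (OrbitSpace G Q)).snd :=
      e'.symm_apply_apply_mk hq.2 _
    change (e (Θ (⟨q, e'.symm (toOrbit G q) (e' (velocityMap (toOrbit G) (z (q, u)))).2⟩, _))).2 = u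
    rw [h1]
    change (e (Θ (splitting G EB L (z (q, u))))).2 = u
    rw [hΘ]
    exact congrArg Prod.snd (e.apply_mk_symm hq.1 u)
  have hXs := contMDiffAt_of_leftInverse_of_hasFDerivAt hFl A (by simpa only [hFl₀] using hA) hX
  have hid : ContMDiffAt ((𝓘(ℝ, E).prod 𝓘(ℝ, Fin k → EB)).prod 𝓘(ℝ, Fin k → EG →L[ℝ] ℝ))
      (𝓘(ℝ, E).prod 𝓘(ℝ, Fin k → EB)) ∞
      (fun y : PulledVelocity k Q G EB × (Fin k → EG →L[ℝ] ℝ) => y.1) (splitting G EB L v₀) :=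
    contMDiffAt_fst
  obtain ⟨hid1, hid2⟩ := Bundle.contMDiffAt_totalSpace.1 hid
  let T : PulledVelocity k Q G EB × (Fin k → EG →L[ℝ] ℝ) →
      Q × ((Fin k → EB) × (Fin k → EG →L[ℝ] ℝ)) := fun y =>
    (y.1.proj, ((e' ⟨toOrbit G y.1.proj, y.1.snd⟩).2, y.2))
  have hT : ContMDiffAt ((𝓘(ℝ, E).prod 𝓘(ℝ, Fin k → EB)).prod 𝓘(ℝ, Fin k → EG →L[ℝ] ℝ))
      (𝓘(ℝ, E).prod 𝓘(ℝ, (Fin k → EB) × (Fin k → EG →L[ℝ] ℝ))) ∞ T (splitting G EB L v₀) :=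
    hid1.prodMk (ContMDiffAt.prodMk_space hid2 contMDiffAt_snd)
  have hT₀ : T (splitting G EB L v₀) = (q₀, Fl (q₀, v₀.snd)) := by
    refine congrArg (Prod.mk q₀) (Eq.trans (b := (kfold k (E := E) (orbitDeriv G EB q₀) v₀.snd,
      momentum EG G L v₀)) ?_ (hFl₀ v₀.snd).symm)
    refine Prod.ext ?_ rfl
    exact velocity_trivializationAt_self _ _
  have hXT : ContMDiffAt ((𝓘(ℝ, E).prod 𝓘(ℝ, Fin k → EB)).prod 𝓘(ℝ, Fin k → EG →L[ℝ] ℝ))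
      𝓘(ℝ, Fin k → E) ∞ (X ∘ T) (splitting G EB L v₀) :=
    ContMDiffAt.comp _ (hT₀ ▸ hXs) hT
  have hproj : ∀ y, (Θ y).proj = y.1.proj := by
    intro y
    obtain ⟨v, rfl⟩ := (splitting_bijective hfree hπ hreg).2 y
    rw [hΘ]
    rfl
  rw [Bundle.contMDiffAt_totalSpace]
  refine ⟨hid1.congr_of_eventuallyEq (.of_forall hproj), ?_⟩
  rw [hΘ]
  refine hXT.congr_of_eventuallyEq ?_
  filter_upwards [hid1.continuousAt.eventually hbase] with y hy
  have h1 : e'.symm (toOrbit G y.1.proj) (e' ⟨toOrbit G y.1.proj, y.1.snd⟩).2 = y.1.snd :=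
    e'.symm_apply_apply_mk hy.2 _
  change (e (Θ y)).2 = (e (Θ (⟨y.1.proj,
    e'.symm (toOrbit G y.1.proj) (e' ⟨toOrbit G y.1.proj, y.1.snd⟩).2⟩, y.2))).2
  rw [h1]

/-- The splitting `v ↦ ((q, Tπ(v₁), …, Tπ(vₖ)), J_L(v))` is a diffeomorphism when `L` is
`G`-regular. -/
theorem exists_splitting_diffeomorph [ProperSMul G Q]
    (hfree : ∀ (g : G) (q : Q), g • q = q → g = 1)
    (hπ : Manifold.IsSubmersionOfComplement F 𝓘(ℝ, E) 𝓘(ℝ, EB) ∞ (toOrbit G : Q → OrbitSpace G Q))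
    {L : VelocityBundle E k Q → ℝ}
    (hL : ContMDiff (𝓘(ℝ, E).prod 𝓘(ℝ, Fin k → E)) 𝓘(ℝ, ℝ) ∞ L) (hreg : IsGRegular EG G L) :
    ∃ Θ : VelocityBundle E k Q ≃ₘ^∞⟮𝓘(ℝ, E).prod 𝓘(ℝ, Fin k → E),
        (𝓘(ℝ, E).prod 𝓘(ℝ, Fin k → EB)).prod 𝓘(ℝ, Fin k → EG →L[ℝ] ℝ)⟯
        (PulledVelocity k Q G EB × (Fin k → EG →L[ℝ] ℝ)),
      ∀ v, Θ v = splitting G EB L v := by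
  let Θ := Equiv.ofBijective _ (splitting_bijective hfree hπ hreg)
  have hΘ : ∀ v, Θ.symm (splitting G EB L v) = v := Θ.symm_apply_apply
  refine ⟨⟨Θ, contMDiff_splitting hπ.contMDiff hL, fun y => ?_⟩, fun _ => rfl⟩
  obtain ⟨v, rfl⟩ := (splitting_bijective hfree hπ hreg).2 y
  exact contMDiffAt_splitting_inverse hfree hπ hL hreg hΘ v

end LegendreSplitting

/-! ### Vector charts of products and bundles; submersions under diffeomorphisms -/

section VectorChart

variable {E : Type*} [NormedAddCommGroup E] [NormedSpace ℝ E]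
  {H : Type*} [TopologicalSpace H] {I : ModelWithCorners ℝ E H}
  {M : Type*} [TopologicalSpace M] [ChartedSpace H M]
  {E' : Type*} [NormedAddCommGroup E'] [NormedSpace ℝ E']
  {H' : Type*} [TopologicalSpace H'] {J : ModelWithCorners ℝ E' H'}
  {N : Type*} [TopologicalSpace N] [ChartedSpace H' N]
  {V W F : Type*} [NormedAddCommGroup V] [NormedSpace ℝ V]
  [NormedAddCommGroup W] [NormedSpace ℝ W] [NormedAddCommGroup F] [NormedSpace ℝ F]

namespace IsVectorChart

theorem prod {φ : OpenPartialHomeomorph M V} (hφ : IsVectorChart I φ)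
    {ψ : OpenPartialHomeomorph N W} (hψ : IsVectorChart J ψ) :
    IsVectorChart (I.prod J) (φ.prod ψ) where
  contMDiffOn := (hφ.contMDiffOn.comp contMDiffOn_fst fun _ h => h.1).prodMk_space
    (hψ.contMDiffOn.comp contMDiffOn_snd fun _ h => h.2)
  contMDiffOn_symm :=
    (hφ.contMDiffOn_symm.comp (f := Prod.fst) contDiffOn_fst.contMDiffOn fun _ h => h.1).prodMk
      (hψ.contMDiffOn_symm.comp (f := Prod.snd) contDiffOn_snd.contMDiffOn fun _ h => h.2)

theorem subRight (w : W) :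
    IsVectorChart 𝓘(ℝ, W) (Homeomorph.subRight w).toOpenPartialHomeomorph where
  contMDiffOn := (contDiff_id.sub contDiff_const).contMDiff.contMDiffOn
  contMDiffOn_symm := (contDiff_id.add contDiff_const).contMDiff.contMDiffOn

theorem bundleChart {B : Type*} [TopologicalSpace B] [ChartedSpace H B]
    {Z : B → Type*} [TopologicalSpace (Bundle.TotalSpace F Z)] [∀ x, AddCommMonoid (Z x)]
    [∀ x, Module ℝ (Z x)] [∀ x, TopologicalSpace (Z x)] [FiberBundle F Z] [VectorBundle ℝ F Z]
    [ContMDiffVectorBundle ∞ F Z I] (t : Bundle.Trivialization F (Bundle.TotalSpace.proj (E := Z)))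
    [MemTrivializationAtlas t] {φ : OpenPartialHomeomorph B V} (hφ : IsVectorChart I φ) :
    IsVectorChart (I.prod 𝓘(ℝ, F))
      (t.toOpenPartialHomeomorph.trans (φ.prod (OpenPartialHomeomorph.refl F))) where
  contMDiffOn := by
    have h1 := t.contMDiffOn (IB := I) (n := ∞)
    have h2 : ContMDiffOn (I.prod 𝓘(ℝ, F)) 𝓘(ℝ, V × F) ∞ (φ.prod (OpenPartialHomeomorph.refl F))
        (φ.prod (OpenPartialHomeomorph.refl F)).source :=
      (hφ.contMDiffOn.comp contMDiffOn_fst fun _ h => h.1).prodMk_space contMDiffOn_snd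
    exact h2.comp (h1.mono fun x hx => hx.1) fun x hx => hx.2
  contMDiffOn_symm := by
    have h1 := t.contMDiffOn_symm (IB := I) (n := ∞)
    have h2 : ContMDiffOn 𝓘(ℝ, V × F) (I.prod 𝓘(ℝ, F)) ∞
        (φ.prod (OpenPartialHomeomorph.refl F)).symm
        (φ.prod (OpenPartialHomeomorph.refl F)).target :=
      (hφ.contMDiffOn_symm.comp (f := Prod.fst) contDiffOn_fst.contMDiffOn fun _ h => h.1).prodMk
        contDiffOn_snd.contMDiffOn
    exact h1.comp (h2.mono fun x hx => hx.1) fun x hx => hx.2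

end IsVectorChart

theorem IsSubmersionAtOfComplement.diffeomorph_conj [I.Boundaryless] [J.Boundaryless]
    [IsManifold I ∞ M] [IsManifold J ∞ N] {X Y : Type*} [TopologicalSpace X] [TopologicalSpace Y]
    [ChartedSpace V X] [ChartedSpace W Y] [IsManifold 𝓘(ℝ, V) ∞ X] [IsManifold 𝓘(ℝ, W) ∞ Y]
    (ℓ : E ≃L[ℝ] V) (ℓ' : E' ≃L[ℝ] W) (D : X ≃ₘ^∞⟮𝓘(ℝ, V), I⟯ M) (D' : Y ≃ₘ^∞⟮𝓘(ℝ, W), J⟯ N)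
    {f : M → N} {g : X → Y} (hg : ∀ x, D' (g x) = f (D x)) {x : X}
    (hf : Manifold.IsSubmersionAtOfComplement F I J ∞ f (D x)) :
    Manifold.IsSubmersionAtOfComplement F 𝓘(ℝ, V) 𝓘(ℝ, W) ∞ g x := by
  obtain ⟨φ, ψ, e, hφ, hψ, hx, hm, h⟩ := IsSubmersionAtOfComplement.exists_vectorChart hf
  refine (hφ.diffeomorph_trans D).isSubmersionAtOfComplement (hψ.diffeomorph_trans D') ℓ ℓ' e hx
    (fun y hy => ?_) (fun y hy => ?_)
  · change D' (g y) ∈ ψ.source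
    rw [hg]
    exact hm hy
  · change ψ (D' (g y)) = (e (φ (D y))).1
    rw [hg]
    exact h _ hy

end VectorChart

/-! ### Equivariance of the momentum map -/

section Equivariance

variable {k : ℕ}
  {E : Type*} [NormedAddCommGroup E] [NormedSpace ℝ E]
  {EG : Type*} [NormedAddCommGroup EG] [NormedSpace ℝ EG]
  {Q : Type*} [TopologicalSpace Q] [ChartedSpace E Q] [IsManifold 𝓘(ℝ, E) ∞ Q]
  {G : Type*} [Group G] [TopologicalSpace G] [ChartedSpace EG G] [LieGroup 𝓘(ℝ, EG) ∞ G]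
  [MulAction G Q] [ContMDiffSMul 𝓘(ℝ, EG) 𝓘(ℝ, E) ∞ G Q]

/-- Differentiate `h • g • q = g • (g⁻¹ h g) • q` at `h = 1`. -/
theorem generator_smul (g : G) (q : Q) (ξ : EG) :
    (generator E EG G (g • q) ξ : E) =
      mfderiv 𝓘(ℝ, E) 𝓘(ℝ, E) (fun q : Q => g • q) q
        (generator E EG G q (Ad (EG := EG) g⁻¹ ξ)) := by
  have hc : HasMFDerivAt 𝓘(ℝ, EG) 𝓘(ℝ, EG) (fun h : G => g⁻¹ * h * g⁻¹⁻¹) 1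
      (mfderiv 𝓘(ℝ, EG) 𝓘(ℝ, EG) (fun h : G => g⁻¹ * h * g⁻¹⁻¹) 1) := by
    have h : ContMDiff 𝓘(ℝ, EG) 𝓘(ℝ, EG) ∞ (fun h : G => g⁻¹ * h * g⁻¹⁻¹) :=
      (contMDiff_const.mul contMDiff_id).mul contMDiff_const
    exact (h.mdifferentiable (by simp) 1).hasMFDerivAt
  have h1 : g⁻¹ * 1 * g⁻¹⁻¹ = 1 := by simp
  have ho : HasMFDerivAt 𝓘(ℝ, EG) 𝓘(ℝ, E) (fun g : G => g • q) (g⁻¹ * 1 * g⁻¹⁻¹)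
      (mfderiv 𝓘(ℝ, EG) 𝓘(ℝ, E) (fun g : G => g • q) (g⁻¹ * 1 * g⁻¹⁻¹)) :=
    ((contMDiff_smul_const EG q).mdifferentiable (by simp) _).hasMFDerivAt
  have hs : HasMFDerivAt 𝓘(ℝ, E) 𝓘(ℝ, E) (fun q : Q => g • q) ((g⁻¹ * 1 * g⁻¹⁻¹) • q)
      (mfderiv 𝓘(ℝ, E) 𝓘(ℝ, E) (fun q : Q => g • q) ((g⁻¹ * 1 * g⁻¹⁻¹) • q)) :=
    ((contMDiff_const_smul EG g).mdifferentiable (by simp) _).hasMFDerivAt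
  have h2 := (hs.comp (1 : G) (ho.comp (1 : G) hc)).mfderiv
  have h3 : (fun q : Q => g • q) ∘ (fun h : G => h • q) ∘ (fun h : G => g⁻¹ * h * g⁻¹⁻¹)
      = fun h : G => h • g • q := by
    funext h
    simp [smul_smul, mul_assoc]
  rw [h3] at h2
  have h4 := DFunLike.congr_fun h2 ξ
  refine h4.trans ?_
  have h5 : ∀ h : G, h = 1 →
      (mfderiv 𝓘(ℝ, E) 𝓘(ℝ, E) (fun q : Q => g • q) (h • q) : E →L[ℝ] E)
        ((mfderiv 𝓘(ℝ, EG) 𝓘(ℝ, E) (fun g : G => g • q) h : EG →L[ℝ] E) (Ad (EG := EG) g⁻¹ ξ)) =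
      (mfderiv 𝓘(ℝ, E) 𝓘(ℝ, E) (fun q : Q => g • q) q : E →L[ℝ] E)
        ((generator E EG G q : EG →L[ℝ] E) (Ad (EG := EG) g⁻¹ ξ)) := by
    rintro _ rfl
    rw [one_smul]
    rfl
  exact h5 _ h1

theorem translate_prolong (g : G) (v : VelocityBundle E k Q) (ξ : Fin k → EG) :
    translate EG G (prolong g v) ξ =
      prolong g (translate EG G v (kfold k (Ad (EG := EG) g⁻¹) ξ)) := by
  refine congrArg (Bundle.TotalSpace.mk (g • v.proj)) (funext fun a => ?_)
  refine Eq.trans ?_ (map_add (mfderiv 𝓘(ℝ, E) 𝓘(ℝ, E) (fun q : Q => g • q) v.proj) (v.snd a)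
    (generator E EG G v.proj (Ad (EG := EG) g⁻¹ (ξ a)))).symm
  exact congrArg (fun w : E => (show E from (prolong g v).snd a) + w) (generator_smul g v.proj (ξ a))

/-- By invariance of `L`, translating `prolong g v` by `ξ` has the same effect on `L` as translating
`v` by `Ad_{g⁻¹} ξ`; differentiating at `ξ = 0` gives coadjoint equivariance. -/
theorem momentum_prolong {L : VelocityBundle E k Q → ℝ}
    (hL : ContMDiff (𝓘(ℝ, E).prod 𝓘(ℝ, Fin k → E)) 𝓘(ℝ, ℝ) ∞ L)
    (hinv : ∀ (g : G) (v : VelocityBundle E k Q), L (prolong g v) = L v)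
    (g : G) (v : VelocityBundle E k Q) (a : Fin k) :
    momentum EG G L (prolong g v) a = (momentum EG G L v a).comp (Ad (EG := EG) g⁻¹) := by
  ext ξ
  rw [ContinuousLinearMap.comp_apply, momentum_apply hL, momentum_apply hL]
  have h1 : (fun ξ : Fin k → EG => L (translate EG G (prolong g v) ξ)) =
      (fun ξ : Fin k → EG => L (translate EG G v ξ)) ∘ kfold k (Ad (EG := EG) g⁻¹) := by
    funext ξ
    rw [translate_prolong, hinv]
    rfl
  have h2 := hasFDerivAt_translate (EG := EG) (G := G) hL v
  rw [← map_zero (kfold k (Ad (EG := EG) g⁻¹))] at h2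
  rw [h1, (h2.comp (0 : Fin k → EG) (kfold k (Ad (EG := EG) g⁻¹)).hasFDerivAt).fderiv,
    ContinuousLinearMap.comp_apply, kfold_single, (hasFDerivAt_translate hL v).fderiv]

theorem prolong_mem_levelSet {L : VelocityBundle E k Q → ℝ}
    (hL : ContMDiff (𝓘(ℝ, E).prod 𝓘(ℝ, Fin k → E)) 𝓘(ℝ, ℝ) ∞ L)
    (hinv : ∀ (g : G) (v : VelocityBundle E k Q), L (prolong g v) = L v)
    {μ : Fin k → EG →L[ℝ] ℝ} {g : G} (hg : g ∈ isotropy (G := G) μ) {v : VelocityBundle E k Q}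
    (hv : v ∈ levelSet G L μ) : prolong g v ∈ levelSet G L μ := by
  have hv' : momentum EG G L v = μ := hv
  refine funext fun a => ?_
  rw [momentum_prolong hL hinv, hv']
  exact hg a

end Equivariance

/-! ### The level set, its quotient, and the passage to orbits -/

section Reduction

variable {k : ℕ}
  {E : Type*} [NormedAddCommGroup E] [NormedSpace ℝ E] [FiniteDimensional ℝ E]
  {EG : Type*} [NormedAddCommGroup EG] [NormedSpace ℝ EG] [FiniteDimensional ℝ EG]
  {Q : Type*} [TopologicalSpace Q] [ChartedSpace E Q] [IsManifold 𝓘(ℝ, E) ∞ Q]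
  {G : Type*} [Group G] [TopologicalSpace G] [ChartedSpace EG G] [LieGroup 𝓘(ℝ, EG) ∞ G]
  [MulAction G Q] [ContMDiffSMul 𝓘(ℝ, EG) 𝓘(ℝ, E) ∞ G Q]
  {EB : Type*} [NormedAddCommGroup EB] [NormedSpace ℝ EB] [FiniteDimensional ℝ EB]
  [ChartedSpace EB (OrbitSpace G Q)] [IsManifold 𝓘(ℝ, EB) ∞ (OrbitSpace G Q)]
  {F : Type*} [NormedAddCommGroup F] [NormedSpace ℝ F]
  {H : Subgroup G}
  {EH : Type*} [NormedAddCommGroup EH] [NormedSpace ℝ EH]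
  [ChartedSpace EH (OrbitSpace H Q)] [IsManifold 𝓘(ℝ, EH) ∞ (OrbitSpace H Q)]
  {FH : Type*} [NormedAddCommGroup FH] [NormedSpace ℝ FH]

/-- Locally `p_μ` is the projection `Q → Q/G` composed with a smooth local section of `Q → Q/H`. -/
theorem contMDiff_orbitMap
    (hπ : ContMDiff 𝓘(ℝ, E) 𝓘(ℝ, EB) ∞ (toOrbit G : Q → OrbitSpace G Q))
    (hπH : Manifold.IsSubmersionOfComplement FH 𝓘(ℝ, E) 𝓘(ℝ, EH) ∞
      (toOrbit H : Q → OrbitSpace H Q)) :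
    ContMDiff 𝓘(ℝ, EH) 𝓘(ℝ, EB) ∞ (orbitMap Q H) := by
  intro x
  obtain ⟨q, rfl⟩ : ∃ q, toOrbit H q = x := Quotient.exists_rep x
  obtain ⟨σ, hσ, -, h⟩ := IsSubmersionAtOfComplement.exists_section (hπH q)
  have h1 : ContMDiffAt 𝓘(ℝ, EH) 𝓘(ℝ, EB) ∞ (toOrbit G ∘ σ) (toOrbit H q) :=
    hπ.contMDiffAt.comp _ hσ
  refine h1.congr_of_eventuallyEq ?_
  filter_upwards [h] with z hz
  rw [Function.comp_apply, ← orbitMap_toOrbit H, hz]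

variable (k EB H) in
/-- The pullback `Q/H ×_{Q/G} T¹ₖ(Q/G)` of the velocity bundle of `Q/G` along `Q/H → Q/G`. -/
abbrev QuotientVelocity : Type _ :=
  Bundle.TotalSpace (Fin k → EB)
    (orbitMap Q H *ᵖ (VelocitySpace EB k : OrbitSpace G Q → Type _))

theorem quotientVelocity_ext {x x' : OrbitSpace H Q} (h : x = x') {w w' : Fin k → EB}
    (hw : w = w') : (⟨x, w⟩ : QuotientVelocity (Q := Q) k EB H) = ⟨x', w'⟩ := by
  subst h hw
  rfl

theorem pulledVelocity_ext {q q' : Q} (h : q = q') {w w' : Fin k → EB}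
    (hw : w = w') : (⟨q, w⟩ : PulledVelocity k Q G EB) = ⟨q', w'⟩ := by
  subst h hw
  rfl

variable (H) in
/-- The map `Q ×_{Q/G} T¹ₖ(Q/G) → Q/H ×_{Q/G} T¹ₖ(Q/G)`, `(q, w) ↦ ([q]_H, w)`. -/
def pulledToQuotient (n : PulledVelocity k Q G EB) : QuotientVelocity (Q := Q) k EB H :=
  ⟨toOrbit H n.proj, (n.snd : Fin k → EB)⟩

/-- Both bundles are pulled back from `T¹ₖ(Q/G)`, and the trivializations at `q` and at `[q]_H` come
from the same one at `[q]`. So the map is the identity on fibre coordinates and the submersion `Q →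
Q/H` on the base. -/
theorem isSubmersionOfComplement_pulledToQuotient
    (hπ : ContMDiff 𝓘(ℝ, E) 𝓘(ℝ, EB) ∞ (toOrbit G : Q → OrbitSpace G Q))
    (hπH : Manifold.IsSubmersionOfComplement FH 𝓘(ℝ, E) 𝓘(ℝ, EH) ∞
      (toOrbit H : Q → OrbitSpace H Q)) :
    Manifold.IsSubmersionOfComplement FH (𝓘(ℝ, E).prod 𝓘(ℝ, Fin k → EB))
      (𝓘(ℝ, EH).prod 𝓘(ℝ, Fin k → EB)) ∞
      (pulledToQuotient H : PulledVelocity k Q G EB → QuotientVelocity (Q := Q) k EB H) := by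
  intro n₀
  have := contMDiffVectorBundle_pullback (k := k) (orbitProj Q G) hπ
  have := isManifold_pullback (k := k) (orbitProj Q G) hπ
  have := contMDiffVectorBundle_pullback (k := k) (orbitMap Q H) (contMDiff_orbitMap hπ hπH)
  have := isManifold_pullback (k := k) (orbitMap Q H) (contMDiff_orbitMap hπ hπH)
  obtain ⟨φ, ψ, e, hφ, hψ, hx, hm, h⟩ := IsSubmersionAtOfComplement.exists_vectorChart
    (hπH n₀.proj)
  let t := trivializationAt (Fin k → EB)
    (orbitProj Q G *ᵖ (VelocitySpace EB k : OrbitSpace G Q → Type _)) n₀.proj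
  let t' := trivializationAt (Fin k → EB)
    (orbitMap Q H *ᵖ (VelocitySpace EB k : OrbitSpace G Q → Type _)) (toOrbit H n₀.proj)
  let e' : (E × (Fin k → EB)) ≃L[ℝ] ((EH × (Fin k → EB)) × FH) :=
    (e.prodCongr (.refl ℝ (Fin k → EB))).trans
      ((ContinuousLinearEquiv.prodAssoc ℝ EH FH (Fin k → EB)).trans
        (((ContinuousLinearEquiv.refl ℝ EH).prodCongr
          (ContinuousLinearEquiv.prodComm ℝ FH (Fin k → EB))).trans
        (ContinuousLinearEquiv.prodAssoc ℝ EH (Fin k → EB) FH).symm))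
  refine (hφ.bundleChart t).isSubmersionAtOfComplement (hψ.bundleChart t') (.refl ℝ _) (.refl ℝ _)
    e' ?_ ?_ ?_
  · exact ⟨t.mem_source.2 (FiberBundle.mem_baseSet_trivializationAt' n₀.proj), hx, trivial⟩
  · exact fun n hn => ⟨t'.mem_source.2 (t.mem_source.1 hn.1), hm hn.2.1, trivial⟩
  · intro n hn
    exact Prod.ext (h n.proj hn.2.1) rfl

theorem orbitDeriv_smul
    (hπ : ContMDiff 𝓘(ℝ, E) 𝓘(ℝ, EB) ∞ (toOrbit G : Q → OrbitSpace G Q))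
    {g : G} (hg : ContMDiff 𝓘(ℝ, E) 𝓘(ℝ, E) ∞ (fun q : Q => g • q)) (v : VelocityBundle E k Q) :
    kfold k (E := E) (E' := EB) (orbitDeriv G EB (g • v.proj)) ((prolong g v).snd : Fin k → E) =
      kfold k (E := E) (E' := EB) (orbitDeriv G EB v.proj) (v.snd : Fin k → E) := by
  have h1 : HasMFDerivAt 𝓘(ℝ, E) 𝓘(ℝ, E) (fun q : Q => g • q) v.proj
      (mfderiv 𝓘(ℝ, E) 𝓘(ℝ, E) (fun q : Q => g • q) v.proj) :=
    (hg.mdifferentiable (by simp) _).hasMFDerivAt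
  have h2 : HasMFDerivAt 𝓘(ℝ, E) 𝓘(ℝ, EB) (toOrbit G : Q → OrbitSpace G Q) (g • v.proj)
      (mfderiv 𝓘(ℝ, E) 𝓘(ℝ, EB) (toOrbit G : Q → OrbitSpace G Q) (g • v.proj)) :=
    (hπ.mdifferentiable (by simp) _).hasMFDerivAt
  have h3 := (h2.comp v.proj h1).mfderiv
  have h4 : (toOrbit G : Q → OrbitSpace G Q) ∘ (fun q : Q => g • q) = toOrbit G :=
    funext fun q => Quotient.sound ⟨g, rfl⟩
  rw [h4] at h3
  exact funext fun a => (DFunLike.congr_fun h3 (v.snd a)).symm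

variable (EB H) in
/-- The map `v ↦ ([q]_H, Tπ(v₁), …, Tπ(vₖ))`. -/
def toQuotientVelocity (v : VelocityBundle E k Q) : QuotientVelocity (Q := Q) k EB H :=
  pulledToQuotient H (toPulled G EB v)

theorem toQuotientVelocity_prolong
    (hπ : ContMDiff 𝓘(ℝ, E) 𝓘(ℝ, EB) ∞ (toOrbit G : Q → OrbitSpace G Q))
    (hs : ∀ g : G, ContMDiff 𝓘(ℝ, E) 𝓘(ℝ, E) ∞ (fun q : Q => g • q))
    {g : G} (hg : g ∈ H) (v : VelocityBundle E k Q) :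
    toQuotientVelocity EB H (prolong g v) = toQuotientVelocity EB H v :=
  quotientVelocity_ext (EB := EB) (Quotient.sound ⟨⟨g, hg⟩, rfl⟩) (orbitDeriv_smul hπ (hs g) v)

theorem exists_toPulled_prolong_eq
    (hπ : ContMDiff 𝓘(ℝ, E) 𝓘(ℝ, EB) ∞ (toOrbit G : Q → OrbitSpace G Q))
    (hs : ∀ g : G, ContMDiff 𝓘(ℝ, E) 𝓘(ℝ, E) ∞ (fun q : Q => g • q))
    {v w : VelocityBundle E k Q} (h : toQuotientVelocity EB H v = toQuotientVelocity EB H w) :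
    ∃ g ∈ H, toPulled G EB (prolong g v) = toPulled G EB w := by
  have h1 : toOrbit H w.proj = toOrbit H v.proj := congrArg Bundle.TotalSpace.proj h.symm
  have h2 : kfold k (E := E) (E' := EB) (orbitDeriv G EB v.proj) (v.snd : Fin k → E) =
      kfold k (E := E) (E' := EB) (orbitDeriv G EB w.proj) (w.snd : Fin k → E) :=
    congrArg (fun n : QuotientVelocity (Q := Q) k EB H => (show Fin k → EB from n.snd)) h
  obtain ⟨g, hg⟩ := Quotient.exact h1
  exact ⟨g, g.2, pulledVelocity_ext hg ((orbitDeriv_smul hπ (hs _) v).trans h2)⟩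

variable [ProperSMul G Q]

/-- The splitting carries the level set to the slice `{J_L = μ}` of a product, which gives its
manifold structure; in charts shifted by `μ` the inclusion reads `y ↦ (y, 0)`. -/
theorem exists_levelSet_structure
    (hfree : ∀ (g : G) (q : Q), g • q = q → g = 1)
    (hπ : Manifold.IsSubmersionOfComplement F 𝓘(ℝ, E) 𝓘(ℝ, EB) ∞ (toOrbit G : Q → OrbitSpace G Q))
    {L : VelocityBundle E k Q → ℝ}
    (hL : ContMDiff (𝓘(ℝ, E).prod 𝓘(ℝ, Fin k → E)) 𝓘(ℝ, ℝ) ∞ L) (hreg : IsGRegular EG G L)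
    (μ : Fin k → EG →L[ℝ] ℝ) :
    ∃ (m : ℕ) (_ : ChartedSpace (EuclideanSpace ℝ (Fin m)) (levelSet G L μ))
      (_ : IsManifold (𝓡 m) ∞ (levelSet G L μ)) (_ : (E × (Fin k → EB)) ≃L[ℝ] EuclideanSpace ℝ (Fin m))
      (D : levelSet G L μ ≃ₘ^∞⟮𝓡 m, 𝓘(ℝ, E).prod 𝓘(ℝ, Fin k → EB)⟯ PulledVelocity k Q G EB),
      (∀ v, D v = toPulled G EB v.1) ∧
      Manifold.IsSmoothEmbedding (𝓡 m) (𝓘(ℝ, E).prod 𝓘(ℝ, Fin k → E)) ∞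
        (Subtype.val : levelSet G L μ → VelocityBundle E k Q) := by
  have := isManifold_pullback (k := k) (orbitProj Q G) hπ.contMDiff
  obtain ⟨Θ, hΘ⟩ := exists_splitting_diffeomorph hfree hπ hL hreg
  have hΘ2 : ∀ n : PulledVelocity k Q G EB, Θ.symm (n, μ) ∈ levelSet G L μ := fun n =>
    congrArg Prod.snd ((hΘ _).symm.trans (Θ.apply_symm_apply (n, μ)))
  have hΘμ : ∀ v : levelSet G L μ, Θ v.1 = (toPulled G EB v.1, μ) := fun v =>
    (hΘ v.1).trans (Prod.ext rfl v.2)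
  let h : levelSet G L μ ≃ₜ PulledVelocity k Q G EB :=
    { toFun := fun v => (Θ v.1).1
      invFun := fun n => ⟨Θ.symm (n, μ), hΘ2 n⟩
      left_inv := fun v => Subtype.ext (by
        change Θ.symm ((Θ v.1).1, μ) = v.1
        rw [hΘμ v, ← hΘμ v, Θ.symm_apply_apply])
      right_inv := fun n => by
        change (Θ (Θ.symm (n, μ))).1 = n
        rw [Θ.apply_symm_apply]
      continuous_toFun := continuous_fst.comp (Θ.continuous.comp continuous_subtype_val)
      continuous_invFun := (Θ.symm.continuous.comp
        (continuous_id.prodMk continuous_const)).subtype_mk _ }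
  let ℓ : (E × (Fin k → EB)) ≃L[ℝ] EuclideanSpace ℝ (Fin (Module.finrank ℝ (E × (Fin k → EB)))) :=
    toEuclidean
  obtain ⟨cs, hman, D, hD⟩ := exists_transport_structure
    (I := 𝓘(ℝ, E).prod 𝓘(ℝ, Fin k → EB)) h ℓ
  have hD' : ∀ v, D v = toPulled G EB v.1 := fun v =>
    (hD v).trans (congrArg Prod.fst (hΘμ v))
  refine ⟨_, cs, hman, ℓ, D, hD', ?_, .subtypeVal⟩
  refine Manifold.IsImmersionOfComplement.isImmersion (F := Fin k → EG →L[ℝ] ℝ) fun v => ?_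
  -- Only the linear isomorphism matters here: it identifies the model space of `T¹ₖQ` with that of
  -- the slice times the complement `(𝔤*)^k`.
  obtain ⟨A, -⟩ := exists_fiberwise_derivative_equiv hfree hπ hL hreg v.1
  let ℓ' : ((E × (Fin k → EB)) × (Fin k → EG →L[ℝ] ℝ)) ≃L[ℝ] (E × (Fin k → E)) :=
    (ContinuousLinearEquiv.prodAssoc ℝ E (Fin k → EB) (Fin k → EG →L[ℝ] ℝ)).trans
      ((ContinuousLinearEquiv.refl ℝ E).prodCongr A.symm)
  have hc := IsVectorChart.of_mem_maximalAtlas (I := 𝓘(ℝ, E).prod 𝓘(ℝ, Fin k → EB))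
    (IsManifold.chart_mem_maximalAtlas (I := 𝓘(ℝ, E).prod 𝓘(ℝ, Fin k → EB)) (n := ∞) (D v))
  refine (hc.diffeomorph_trans D).isImmersionAtOfComplement
    ((hc.prod (IsVectorChart.subRight μ)).diffeomorph_trans Θ) ℓ ℓ' (.refl ℝ _)
    ?_ ?_ ?_
  · exact mem_chart_source (ModelProd E (Fin k → EB)) (D v)
  · intro w hw
    refine ⟨?_, trivial⟩
    change (Θ w.1).1 ∈ _
    rw [hΘμ w, ← hD' w]
    exact hw
  · intro w hw
    refine Prod.ext ?_ ?_
    · exact congrArg ((chartAt (ModelProd E (Fin k → EB)) (D v)).transHomeomorph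
        (𝓘(ℝ, E).prod 𝓘(ℝ, Fin k → EB)).toHomeomorph) ((congrArg Prod.fst (hΘμ w)).trans (hD' w).symm)
    · change (Θ w.1).2 - μ = 0
      rw [hΘμ w, sub_self]

/-- Equality on the right yields `g ∈ G_μ` such that `prolong g v` and `w` have the same projection.
By equivariance both have momentum `μ`, so injectivity of the splitting identifies them. -/
theorem toReduced_eq_iff
    (hfree : ∀ (g : G) (q : Q), g • q = q → g = 1)
    (hπ : Manifold.IsSubmersionOfComplement F 𝓘(ℝ, E) 𝓘(ℝ, EB) ∞ (toOrbit G : Q → OrbitSpace G Q))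
    {L : VelocityBundle E k Q → ℝ}
    (hL : ContMDiff (𝓘(ℝ, E).prod 𝓘(ℝ, Fin k → E)) 𝓘(ℝ, ℝ) ∞ L)
    (hinv : ∀ (g : G) (v : VelocityBundle E k Q), L (prolong g v) = L v)
    (hreg : IsGRegular EG G L) {μ : Fin k → EG →L[ℝ] ℝ} {v w : levelSet G L μ} :
    toReduced G L μ v = toReduced G L μ w ↔
      toQuotientVelocity EB (isotropy (G := G) μ) v.1 =
        toQuotientVelocity EB (isotropy (G := G) μ) w.1 := by
  constructor
  · intro h
    obtain ⟨g, hg, hgw⟩ := Quotient.exact h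
    rw [← hgw, toQuotientVelocity_prolong hπ.contMDiff (contMDiff_const_smul EG) hg]
  · intro h
    obtain ⟨g, hg, hgw⟩ := exists_toPulled_prolong_eq hπ.contMDiff (contMDiff_const_smul EG) h
    refine Quotient.sound ⟨g, hg, (splitting_bijective hfree hπ hreg).1 (Prod.ext hgw ?_)⟩
    exact (prolong_mem_levelSet hL hinv hg v.2 : momentum EG G L _ = μ).trans w.2.symm

theorem exists_reducedSpace_homeomorph
    (hfree : ∀ (g : G) (q : Q), g • q = q → g = 1)
    (hπ : Manifold.IsSubmersionOfComplement F 𝓘(ℝ, E) 𝓘(ℝ, EB) ∞ (toOrbit G : Q → OrbitSpace G Q))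
    {μ : Fin k → EG →L[ℝ] ℝ} {EH : Type*} [NormedAddCommGroup EH] [NormedSpace ℝ EH]
    [ChartedSpace EH (OrbitSpace (isotropy (G := G) μ) Q)]
    [IsManifold 𝓘(ℝ, EH) ∞ (OrbitSpace (isotropy (G := G) μ) Q)]
    (hπμ : Manifold.IsSubmersionOfComplement FH 𝓘(ℝ, E) 𝓘(ℝ, EH) ∞
      (toOrbit (isotropy (G := G) μ) : Q → OrbitSpace (isotropy (G := G) μ) Q))
    {L : VelocityBundle E k Q → ℝ}
    (hL : ContMDiff (𝓘(ℝ, E).prod 𝓘(ℝ, Fin k → E)) 𝓘(ℝ, ℝ) ∞ L)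
    (hinv : ∀ (g : G) (v : VelocityBundle E k Q), L (prolong g v) = L v)
    (hreg : IsGRegular EG G L)
    (h : levelSet G L μ ≃ₜ PulledVelocity k Q G EB) (hh : ∀ v, h v = toPulled G EB v.1) :
    ∃ R : ReducedSpace G L μ ≃ₜ QuotientVelocity (Q := Q) k EB (isotropy (G := G) μ),
      ∀ v, R (toReduced G L μ v) = toQuotientVelocity EB (isotropy (G := G) μ) v.1 := by
  have := isManifold_pullback (k := k) (orbitProj Q G) hπ.contMDiff
  have := isManifold_pullback (k := k) (orbitMap Q (isotropy (G := G) μ))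
    (contMDiff_orbitMap hπ.contMDiff hπμ)
  have hsub := isSubmersionOfComplement_pulledToQuotient (k := k) hπ.contMDiff hπμ
  have hiff : ∀ v w : levelSet G L μ, _ ↔ _ := fun v w =>
    toReduced_eq_iff hfree hπ hL hinv hreg (v := v) (w := w)
  have hcont : Continuous fun v : levelSet G L μ =>
      toQuotientVelocity EB (isotropy (G := G) μ) v.1 := by
    have h1 := hsub.contMDiff.continuous.comp h.continuous
    exact h1.congr fun v => congrArg (pulledToQuotient _) (hh v)
  let R : ReducedSpace G L μ → QuotientVelocity (Q := Q) k EB (isotropy (G := G) μ) :=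
    Quotient.lift (fun v => toQuotientVelocity EB (isotropy (G := G) μ) v.1)
      fun v w hvw => (hiff v w).1 (Quotient.sound hvw)
  have hR : ∀ n, R (toReduced G L μ (h.symm n)) = pulledToQuotient _ n := fun n =>
    congrArg (pulledToQuotient _) ((hh _).symm.trans (h.apply_symm_apply n))
  have hsurj : ∀ z, ∃ n : PulledVelocity k Q G EB,
      pulledToQuotient (isotropy (G := G) μ) n = z := by
    rintro ⟨x, w⟩
    obtain ⟨q, rfl⟩ := Quotient.exists_rep x
    exact ⟨⟨q, (w : Fin k → EB)⟩, rfl⟩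
  have hbij : Function.Bijective R := by
    constructor
    · intro a b hab
      induction a using Quotient.ind with | _ v
      induction b using Quotient.ind with | _ w
      exact (hiff v w).2 hab
    · intro z
      obtain ⟨n, rfl⟩ := hsurj z
      exact ⟨_, hR n⟩
  let Re := Equiv.ofBijective R hbij
  refine ⟨⟨Re, hcont.quotient_lift _, ?_⟩, fun v => rfl⟩
  rw [continuous_iff_continuousAt]
  intro z
  obtain ⟨n, rfl⟩ := hsurj z
  -- Near a point the inverse is a local section of the submersion onto the quotient bundle,
  -- followed by `h.symm` and the class map, hence continuous.
  obtain ⟨σ, hσ, -, hz⟩ := IsSubmersionAtOfComplement.exists_section (hsub n)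
  have h1 : ContinuousAt (fun z => toReduced G L μ (h.symm (σ z))) (pulledToQuotient _ n) :=
    ContinuousAt.comp (g := fun n => toReduced G L μ (h.symm n))
      (continuous_quot_mk.comp h.symm.continuous).continuousAt hσ.continuousAt
  refine h1.congr ?_
  filter_upwards [hz] with y hy
  refine (Re.symm_apply_eq.2 ?_).symm
  exact ((hR (σ y)).trans hy).symm

end Reduction

end PolyRouth

end

theorem mainTheorem4 {k : ℕ}
    -- the configuration manifold `Q`
    {E : Type*} [NormedAddCommGroup E] [NormedSpace ℝ E] [FiniteDimensional ℝ E]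
    {Q : Type*} [TopologicalSpace Q] [ChartedSpace E Q] [IsManifold 𝓘(ℝ, E) ∞ Q]
    [T2Space Q] [SecondCountableTopology Q]
    -- the Lie group `G`, acting smoothly, properly and freely on `Q`
    {EG : Type*} [NormedAddCommGroup EG] [NormedSpace ℝ EG] [FiniteDimensional ℝ EG]
    {G : Type*} [Group G] [TopologicalSpace G] [ChartedSpace EG G] [LieGroup 𝓘(ℝ, EG) ∞ G]
    [MulAction G Q] [ContMDiffSMul 𝓘(ℝ, EG) 𝓘(ℝ, E) ∞ G Q] [ProperSMul G Q]
    (hfree : ∀ (g : G) (q : Q), g • q = q → g = 1)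
    (μ : Fin k → EG →L[ℝ] ℝ)
    -- the quotient manifold `Q/G`: the smooth structure for which `Q → Q/G` is a submersion
    {EB : Type*} [NormedAddCommGroup EB] [NormedSpace ℝ EB] [FiniteDimensional ℝ EB]
    [ChartedSpace EB (PolyRouth.OrbitSpace G Q)]
    [IsManifold 𝓘(ℝ, EB) ∞ (PolyRouth.OrbitSpace G Q)]
    (hπ : Manifold.IsSubmersion 𝓘(ℝ, E) 𝓘(ℝ, EB) ∞
      (PolyRouth.toOrbit G : Q → PolyRouth.OrbitSpace G Q))
    -- the quotient manifold `Q/G_μ`: the smooth structure for which `Q → Q/G_μ` is a submersion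
    {Eμ : Type*} [NormedAddCommGroup Eμ] [NormedSpace ℝ Eμ] [FiniteDimensional ℝ Eμ]
    [ChartedSpace Eμ (PolyRouth.OrbitSpace (PolyRouth.isotropy (G := G) μ) Q)]
    [IsManifold 𝓘(ℝ, Eμ) ∞ (PolyRouth.OrbitSpace (PolyRouth.isotropy (G := G) μ) Q)]
    (hπμ : Manifold.IsSubmersion 𝓘(ℝ, E) 𝓘(ℝ, Eμ) ∞
      (PolyRouth.toOrbit (PolyRouth.isotropy (G := G) μ) :
        Q → PolyRouth.OrbitSpace (PolyRouth.isotropy (G := G) μ) Q))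
    -- a smooth `G`-invariant `G`-regular Lagrangian
    (L : PolyRouth.VelocityBundle E k Q → ℝ)
    (hL : ContMDiff (𝓘(ℝ, E).prod 𝓘(ℝ, Fin k → E)) 𝓘(ℝ, ℝ) ∞ L)
    (hinv : ∀ (g : G) (v : PolyRouth.VelocityBundle E k Q), L (PolyRouth.prolong g v) = L v)
    (hreg : PolyRouth.IsGRegular EG G L) :
    -- `p_μ : Q/G_μ → Q/G` is smooth, so that the pullback bundle along it is a smooth bundle
    ContMDiff 𝓘(ℝ, Eμ) 𝓘(ℝ, EB) ∞ (PolyRouth.orbitMap Q (PolyRouth.isotropy (G := G) μ)) ∧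
    -- `J_L⁻¹(μ)` is an embedded submanifold of `T¹ₖQ`
    ∃ (m : ℕ) (_ : ChartedSpace (EuclideanSpace ℝ (Fin m)) (PolyRouth.levelSet G L μ))
      (_ : IsManifold (𝓡 m) ∞ (PolyRouth.levelSet G L μ)),
      Manifold.IsSmoothEmbedding (𝓡 m) (𝓘(ℝ, E).prod 𝓘(ℝ, Fin k → E)) ∞
        (Subtype.val : PolyRouth.levelSet G L μ → PolyRouth.VelocityBundle E k Q) ∧
    -- `J_L⁻¹(μ)/G_μ` is a quotient manifold of `J_L⁻¹(μ)`
    ∃ (r : ℕ) (_ : ChartedSpace (EuclideanSpace ℝ (Fin r)) (PolyRouth.ReducedSpace G L μ))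
      (_ : IsManifold (𝓡 r) ∞ (PolyRouth.ReducedSpace G L μ)),
      Manifold.IsSubmersion (𝓡 m) (𝓡 r) ∞ (PolyRouth.toReduced G L μ) ∧
    -- the diffeomorphism onto `Q/G_μ ×_{Q/G} (T(Q/G) ⊕ ⋯ ⊕ T(Q/G))`
    ∃ Φ : PolyRouth.ReducedSpace G L μ
        ≃ₘ^∞⟮𝓡 r, 𝓘(ℝ, Eμ).prod 𝓘(ℝ, Fin k → EB)⟯
        Bundle.TotalSpace (Fin k → EB)
          (PolyRouth.orbitMap Q (PolyRouth.isotropy (G := G) μ) *ᵖ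
            (PolyRouth.VelocitySpace EB k : PolyRouth.OrbitSpace G Q → Type _)),
      (∀ x, (Φ x).proj = PolyRouth.reducedBase G L μ x) ∧
      ∀ v : PolyRouth.levelSet G L μ,
        Φ (PolyRouth.toReduced G L μ v) =
          ⟨PolyRouth.toOrbit _ v.1.proj,
            fun a => mfderiv 𝓘(ℝ, E) 𝓘(ℝ, EB)
              (PolyRouth.toOrbit G : Q → PolyRouth.OrbitSpace G Q) v.1.proj (v.1.snd a)⟩ := by
  have hπ' := hπ.isSubmersionOfComplement_complement
  have hπμ' := hπμ.isSubmersionOfComplement_complement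
  have hp := PolyRouth.contMDiff_orbitMap hπ'.contMDiff hπμ'
  have := PolyRouth.isManifold_pullback (k := k) (PolyRouth.orbitProj Q G) hπ'.contMDiff
  have := PolyRouth.isManifold_pullback (k := k)
    (PolyRouth.orbitMap Q (PolyRouth.isotropy (G := G) μ)) hp
  obtain ⟨m, cs, hman, ℓ, D, hD, hemb⟩ :=
    PolyRouth.exists_levelSet_structure hfree hπ' hL hreg μ
  obtain ⟨R, hR⟩ := PolyRouth.exists_reducedSpace_homeomorph hfree hπ' hπμ' hL hinv hreg
    D.toHomeomorph hD
  let ℓ' : (Eμ × (Fin k → EB)) ≃L[ℝ]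
      EuclideanSpace ℝ (Fin (Module.finrank ℝ (Eμ × (Fin k → EB)))) := toEuclidean
  obtain ⟨cs', hman', D', hD'⟩ := PolyRouth.exists_transport_structure
    (I := 𝓘(ℝ, Eμ).prod 𝓘(ℝ, Fin k → EB)) R ℓ'
  have hΦ : ∀ v, D' (PolyRouth.toReduced G L μ v) =
      PolyRouth.toQuotientVelocity EB (PolyRouth.isotropy (G := G) μ) v.1 := fun v =>
    (hD' _).trans (hR v)
  refine ⟨hp, m, cs, hman, hemb, _, cs', hman', ?_, D', fun x => ?_, hΦ⟩
  -- Under `D` and `D'` the class map becomes `(q, w) ↦ ([q]_μ, w)`, already known to be a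
  -- submersion.
  · refine Manifold.IsSubmersionOfComplement.isSubmersion (F := hπμ.complement) fun v =>
      PolyRouth.IsSubmersionAtOfComplement.diffeomorph_conj ℓ ℓ' D D' (fun w => ?_)
        (PolyRouth.isSubmersionOfComplement_pulledToQuotient (k := k) hπ'.contMDiff hπμ' (D v))
    rw [hΦ, hD]
    rfl
  · induction x using Quotient.ind with | _ v
    exact congrArg Bundle.TotalSpace.proj (hΦ v)
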